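/- Let $n\ge 1$ and write points of $\mathbb R^n$ as $x=(x',x_n)\in\mathbb R^{n-1}\times\mathbb R$. For an open set $D\subset\mathbb R^n$, $s\in(0,1)$, $1\le p<\infty$ and a measurable $u:D\to\mathbb R^n$ put $$|u|_{W^{s,p}(D)}^p=\int_D\int_D\frac{|u(x)-u(y)|^p}{|x-y|^{n+ps}}\,dx\,dy,\qquad [u]_{\mathcal X^{s,p}(D)}^p=\int_D\int_D\frac{\bigl|(u(y)-u(x))\cdot\frac{y-x}{|y-x|}\bigr|^p}{|y-x|^{n+ps}}\,dy\,dx,$$ let $W^{s,p}(D;\mathbb R^n)$ be the space of $u\in L^p(D;\mathbb R^n)$ with $|u|_{W^{s,p}(D)}<\infty$, and put $\|u\|_{W^{s,p}(D)}=\|u\|_{L^p(D)}+|u|_{W^{s,p}(D)}$. For a Lipschitz function $f:\mathbb R^{n-1}\to\mathbb R$ let $D=\{x: x_n>f(x')\}$ and $D_-=\{x: x_n<f(x')\}$; for $\eta>0$ let $\Phi_\eta(x)=(x',\,f(x')+\eta(f(x')-x_n))$, which maps $D_-$ to $D$. For $0<\lambda<\mu$ let $$k=\frac{1+\mu}{\mu-\lambda},\quad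 \ell=-\frac{1+\lambda}{\mu-\lambda},\quad m=-\frac{\lambda(1+\mu)}{\mu-\lambda},\quad q=\frac{\mu(1+\lambda)}{\mu-\lambda},$$ and define the linear operator $E=E_{f,\lambda,\mu}$ by $Eu=u$ on $D$ and, for $x\in D_-$, $$(Eu)_i(x)=k\,u_i(\Phi_\lambda(x))+\ell\,u_i(\Phi_\mu(x))\ \ (1\le i\le n-1),\qquad (Eu)_n(x)=m\,u_n(\Phi_\lambda(x))+q\,u_n(\Phi_\mu(x))$$ (the value on the graph of $f$, a null set, is immaterial). Then there is a constant $c_2\ge 1$ depending only on $n$ such that, for all $s\in(0,1)$ and $1\le p<\infty$, there is a constant $c>0$ depending only on $n,p,s$, and for every $M\ge0$ there are constants $C,K>0$ depending only on $n,p,s,M$, with the following property. Let $f$ be Lipschitz with constant $M$ (that is, $\|\nabla f\|_{L^\infty}\le M$), and let $\lambda=1-\delta$, $\mu=1+\delta$ with $\delta=\frac{1}{2c_2\sqrt n(1+M)}$. Then $E$ is a well-defined (vector fields equal a.e. on $D$ have extensions equal a.e. on $\mathbb R^n$) bounded linear extension operator from $W^{s,p}(D;\mathbb R^n)$ to $W^{s,p}(\mathbb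 R^n;\mathbb R^n)$: for all $u\in W^{s,p}(D;\mathbb R^n)$ one has $Eu=u$ on $D$, $Eu\in W^{s,p}(\mathbb R^n;\mathbb R^n)$ and $\|Eu\|_{W^{s,p}(\mathbb R^n)}\le K\|u\|_{W^{s,p}(D)}$; and moreover $$[Eu]_{\mathcal X^{s,p}(\mathbb R^n)}\le C\,[u]_{\mathcal X^{s,p}(D)}+c\,(1+M)^{2+\frac{n}{2p}}\,M\,|u|_{W^{s,p}(D)}.$$ -/

import Mathlib

open MeasureTheory Set
open scoped ENNReal NNReal

/-- The Gagliardo seminorm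
`|u|_{W^{s,p}(D)} = (∫_D ∫_D |u(x) - u(y)|^p / |x - y|^{n + p s} dx dy)^{1/p}`,
with values in `[0, ∞]`. -/
noncomputable def sobolevSeminorm {n : ℕ} (s p : ℝ) (D : Set (EuclideanSpace ℝ (Fin n)))
    (u : EuclideanSpace ℝ (Fin n) → EuclideanSpace ℝ (Fin n)) : ℝ≥0∞ :=
  (∫⁻ x in D, ∫⁻ y in D,
    ENNReal.ofReal (‖u x - u y‖ ^ p / ‖x - y‖ ^ ((n : ℝ) + p * s))) ^ (1 / p)

/-- The seminorm of the projected difference quotient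
`[u]_{X^{s,p}(D)} =
  (∫_D ∫_D |(u(y) - u(x)) ⬝ (y - x) / |y - x||^p / |y - x|^{n + p s} dy dx)^{1/p}`,
with values in `[0, ∞]`. -/
noncomputable def projectedSeminorm {n : ℕ} (s p : ℝ) (D : Set (EuclideanSpace ℝ (Fin n)))
    (u : EuclideanSpace ℝ (Fin n) → EuclideanSpace ℝ (Fin n)) : ℝ≥0∞ :=
  (∫⁻ x in D, ∫⁻ y in D,
    ENNReal.ofReal
      (|inner ℝ (u y - u x) (y - x) / ‖y - x‖| ^ p / ‖y - x‖ ^ ((n : ℝ) + p * s))) ^ (1 / p)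

/-- `u` (more precisely its class modulo equality almost everywhere on `D`) belongs to
`W^{s,p}(D; ℝⁿ)`. -/
def MemSobolev {n : ℕ} (s p : ℝ) (D : Set (EuclideanSpace ℝ (Fin n)))
    (u : EuclideanSpace ℝ (Fin n) → EuclideanSpace ℝ (Fin n)) : Prop :=
  MemLp u (ENNReal.ofReal p) (volume.restrict D) ∧ sobolevSeminorm s p D u < ∞

/-- The norm `‖u‖_{W^{s,p}(D)} = ‖u‖_{L^p(D)} + |u|_{W^{s,p}(D)}`. -/
noncomputable def sobolevNorm {n : ℕ} (s p : ℝ) (D : Set (EuclideanSpace ℝ (Fin n)))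
    (u : EuclideanSpace ℝ (Fin n) → EuclideanSpace ℝ (Fin n)) : ℝ≥0∞ :=
  eLpNorm u (ENNReal.ofReal p) (volume.restrict D) + sobolevSeminorm s p D u

/-- The first `n - 1` coordinates `x'` of a point `x = (x', x_n)` of `ℝⁿ`, where `n = d + 1`. -/
noncomputable def horizontalPart {d : ℕ} (x : EuclideanSpace ℝ (Fin (d + 1))) :
    EuclideanSpace ℝ (Fin d) :=
  WithLp.toLp 2 (fun i => x i.castSucc)

/-- The epigraph `D = {(x', x_n) : x_n > f(x')}`. -/
def epigraph {d : ℕ} (f : EuclideanSpace ℝ (Fin d) → ℝ) :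
    Set (EuclideanSpace ℝ (Fin (d + 1))) :=
  {x | f (horizontalPart x) < x (Fin.last d)}

/-- The set `D₋ = {(x', x_n) : x_n < f(x')}`. -/
def strictHypograph {d : ℕ} (f : EuclideanSpace ℝ (Fin d) → ℝ) :
    Set (EuclideanSpace ℝ (Fin (d + 1))) :=
  {x | x (Fin.last d) < f (horizontalPart x)}

/-- The reflection `Φ_η(x) = (x', f(x') + η (f(x') - x_n))`. -/
noncomputable def epigraphReflection {d : ℕ} (f : EuclideanSpace ℝ (Fin d) → ℝ) (η : ℝ)
    (x : EuclideanSpace ℝ (Fin (d + 1))) : EuclideanSpace ℝ (Fin (d + 1)) :=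
  WithLp.toLp 2 (Fin.snoc (α := fun _ => ℝ) (fun i : Fin d => x i.castSucc)
    (f (horizontalPart x) + η * (f (horizontalPart x) - x (Fin.last d))))

/-- The `i`-th component on `D₋` of the extension of `u`: it is `k u_i(Φ_lam x) + l u_i(Φ_mu x)`
for `i < n` and `m u_n(Φ_lam x) + q u_n(Φ_mu x)` for `i = n`, where
`k = (1 + mu) / (mu - lam)`, `l = -(1 + lam) / (mu - lam)`, `m = -lam (1 + mu) / (mu - lam)` and
`q = mu (1 + lam) / (mu - lam)`. -/
noncomputable def nitscheComponent {d : ℕ} (f : EuclideanSpace ℝ (Fin d) → ℝ) (lam mu : ℝ)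
    (u : EuclideanSpace ℝ (Fin (d + 1)) → EuclideanSpace ℝ (Fin (d + 1)))
    (x : EuclideanSpace ℝ (Fin (d + 1))) (i : Fin (d + 1)) : ℝ :=
  if i = Fin.last d then
    -(lam * (1 + mu) / (mu - lam)) * u (epigraphReflection f lam x) i
      + mu * (1 + lam) / (mu - lam) * u (epigraphReflection f mu x) i
  else
    (1 + mu) / (mu - lam) * u (epigraphReflection f lam x) i
      + -((1 + lam) / (mu - lam)) * u (epigraphReflection f mu x) i

open Classical in
/-- Nitsche's extension, as a linear operator on vector fields: `u` itself on `D`, the combination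
of the two reflections of `u` on `D₋`, and `0` on the graph of `f` (a null set). -/
noncomputable def nitscheExtension {d : ℕ} (f : EuclideanSpace ℝ (Fin d) → ℝ) (lam mu : ℝ) :
    (EuclideanSpace ℝ (Fin (d + 1)) → EuclideanSpace ℝ (Fin (d + 1))) →ₗ[ℝ]
      (EuclideanSpace ℝ (Fin (d + 1)) → EuclideanSpace ℝ (Fin (d + 1))) where
  toFun u x :=
    if x ∈ epigraph f then u x
    else if x ∈ strictHypograph f then WithLp.toLp 2 (nitscheComponent f lam mu u x)
    else 0
  map_add' u v := by
    ext x i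
    simp only [Pi.add_apply]
    split_ifs
    · rfl
    · simp only [nitscheComponent, Pi.add_apply, PiLp.add_apply]
      split_ifs <;> ring
    · simp
  map_smul' a u := by
    ext x i
    simp only [Pi.smul_apply, RingHom.id_apply]
    split_ifs
    · rfl
    · simp only [nitscheComponent, Pi.smul_apply, PiLp.smul_apply, smul_eq_mul]
      split_ifs <;> ring
    · simp

/-- The parameter `δ = 1 / (2 c₂ √n (1 + M))`. -/
noncomputable def reflectionParameter (n : ℕ) (c₂ M : ℝ) : ℝ :=
  1 / (2 * c₂ * √(n : ℝ) * (1 + M))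

/-! ### Changes of variables in `L^p` seminorms -/

/-! The estimate rests on a fractional Korn inequality: on an epigraph, every `u` with finite
Gagliardo seminorm satisfies `|u|_W ≤ a [u]_X`, with `a` depending on `n, p, s, M`
(`exists_sobolevSeminorm_le_projectedSeminorm`). Since `[Eu]_X ≤ |Eu|_W` always, and `|Eu|_W ≤ k
|u|_W` because reflections across a Lipschitz graph are Lipschitz, it follows that `[Eu]_X ≤ k a
[u]_X`. The term with `c` is then only added on the right, and the precise values of `c` and `c₂`
play no role.

Korn inequality. The epigraph is stable under adding vectors of a cone. For `h` in a narrower cone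
the points `x, x + h, x + 2h, x + Bh, x + h + Bh` all lie in the domain, and a linear relation among
projected differences along the edges joining them recovers each component of the second difference
`u(x + 2h) - 2u(x + h) + u(x)` (`inner_second_difference_eq`, `exists_eLpNorm_secondQuotient_le`).
First differences follow from second ones by `u(x + h) - u(x) = (u(x + 2h) - u(x)) / 2 - (second
difference) / 2`: after rescaling, the first term on the right has norm at most `2 ^ (s - 1) < 1`
times that of the left side, and is absorbed since the latter is finite
(`eLpNorm_incrementQuotient_le`). Finally two arbitrary points of the domain are joined through a
common apex above both (`exists_eLpNorm_gagliardoQuotient_le`).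

Boundedness of `E`. Off the graph, `Eu` is a fixed linear combination of `u ∘ foldMap f λ` and `u ∘
foldMap f μ` (`nitscheExtension_eq_foldMap`). The fold is globally Lipschitz and pushes Lebesgue
measure to at most a multiple of Lebesgue measure on the epigraph (`map_foldMap_le`), so no separate
estimate for pairs on opposite sides of the graph is needed. -/

theorem eLpNorm_comp_le_of_map_le {α β F : Type*} [MeasurableSpace α] [MeasurableSpace β]
    [NormedAddCommGroup F] {μ : Measure α} {ν : Measure β} {T : α → β} (hT : Measurable T)
    {c : ℝ≥0∞} (h : μ.map T ≤ c • ν) {p : ℝ≥0∞} (hp : p ≠ ∞) {g : β → F}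
    (hg : StronglyMeasurable g) :
    eLpNorm (fun x => g (T x)) p μ ≤ c ^ (1 / p).toReal * eLpNorm g p ν := by
  have h1 := eLpNorm_map_measure (p := p) (hg.aestronglyMeasurable (μ := μ.map T)) hT.aemeasurable
  have h2 := eLpNorm_smul_measure_of_ne_top (μ := ν) hp g c
  rw [smul_eq_mul] at h2
  rw [← h2]
  exact h1.symm.le.trans (eLpNorm_mono_measure g h)

theorem map_restrict_linearMap_le {W : Type*} [NormedAddCommGroup W] [NormedSpace ℝ W]
    [FiniteDimensional ℝ W] [MeasurableSpace W] [BorelSpace W] (μ : Measure W)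
    [μ.IsAddHaarMeasure] {T : W →ₗ[ℝ] W} (hT : Function.Injective T) {S A : Set W}
    (hA : MeasurableSet A) (hSA : MapsTo T S A) :
    (μ.restrict S).map T ≤ ENNReal.ofReal |(LinearMap.det T)⁻¹| • μ.restrict A := by
  have hdet : LinearMap.det T ≠ 0 := by
    have := LinearEquiv.isUnit_det' (LinearEquiv.ofInjectiveEndo T hT)
    exact this.ne_zero
  have hm : Measurable T := T.continuous_of_finiteDimensional.measurable
  rw [← Measure.restrict_smul, ← Measure.map_linearMap_addHaar_eq_smul_addHaar μ hdet,
    Measure.restrict_map hm hA]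
  exact Measure.map_mono (Measure.restrict_mono hSA le_rfl) hm

/-- Injective linear substitutions are bounded on `L^p`. -/
theorem eLpNorm_comp_linearMap_le {W F : Type*} [NormedAddCommGroup W] [NormedSpace ℝ W]
    [FiniteDimensional ℝ W] [MeasurableSpace W] [BorelSpace W] [NormedAddCommGroup F]
    (μ : Measure W) [μ.IsAddHaarMeasure] {T : W →ₗ[ℝ] W} (hT : Function.Injective T)
    {S A : Set W} (hA : MeasurableSet A) (hSA : MapsTo T S A) {p : ℝ≥0∞} (hp : p ≠ ∞) {g : W → F}
    (hg : StronglyMeasurable g) :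
    eLpNorm (fun x => g (T x)) p (μ.restrict S) ≤
      ENNReal.ofReal |(LinearMap.det T)⁻¹| ^ (1 / p).toReal * eLpNorm g p (μ.restrict A) :=
  eLpNorm_comp_le_of_map_le T.continuous_of_finiteDimensional.measurable
    (map_restrict_linearMap_le μ hT hA hSA) hp hg

/-- The constant depends only on the determinant of `T` and on `p`, not on the sets or the function;
this is what makes the Korn constant uniform over all domains absorbing the same cone. -/
theorem exists_eLpNorm_comp_linearMap_le {W : Type*} [NormedAddCommGroup W]
    [NormedSpace ℝ W] [FiniteDimensional ℝ W] [MeasurableSpace W] [BorelSpace W]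
    (μ : Measure W) [μ.IsAddHaarMeasure] {T : W →ₗ[ℝ] W}
    (hT : Function.Injective T) {p : ℝ≥0∞} (hp : p ≠ ∞) (F : Type*) [NormedAddCommGroup F] :
    ∃ c : ℝ≥0, ∀ (S A : Set W), MeasurableSet A → MapsTo T S A → ∀ g : W → F,
      StronglyMeasurable g →
        eLpNorm (fun x => g (T x)) p (μ.restrict S) ≤ c * eLpNorm g p (μ.restrict A) := by
  refine ⟨(ENNReal.ofReal |(LinearMap.det T)⁻¹| ^ (1 / p).toReal).toNNReal,
    fun S A hA hSA g hg => ?_⟩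
  rw [ENNReal.coe_toNNReal (ENNReal.rpow_ne_top_of_nonneg (by positivity) (by simp))]
  exact eLpNorm_comp_linearMap_le μ hT hA hSA hp hg

theorem rpow_neg_le_of_le_mul {a b C r : ℝ} (ha : 0 < a) (hC : 0 < C) (hr : 0 ≤ r)
    (h : a ≤ C * b) : b ^ (-r) ≤ C ^ r * a ^ (-r) := by
  have hb : 0 < b := by
    by_contra hb
    nlinarith
  have h1 : (C * b) ^ (-r) ≤ a ^ (-r) := Real.rpow_le_rpow_of_nonpos ha h (by linarith)
  have h2 : b ^ (-r) = C ^ r * (C * b) ^ (-r) := by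
    rw [Real.mul_rpow hC.le hb.le, ← mul_assoc, ← Real.rpow_add hC]
    simp
  rw [h2]
  gcongr

/-! ### The seminorms as `L^p` norms on the product space -/

/-- The space `ℝⁿ` with `n = d + 1`. -/
abbrev Pt (d : ℕ) := EuclideanSpace ℝ (Fin (d + 1))

variable {d : ℕ}

/-- The difference quotient whose `L^p` norm is the Gagliardo seminorm. -/
noncomputable def gagliardoQuotient (r : ℝ) (u : Pt d → Pt d) (z : Pt d × Pt d) : Pt d :=
  ‖z.1 - z.2‖ ^ (-r) • (u z.1 - u z.2)

/-- The projected difference quotient. -/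
noncomputable def projectedQuotient (r : ℝ) (u : Pt d → Pt d) (z : Pt d × Pt d) : ℝ :=
  ‖z.2 - z.1‖ ^ (-r) * (inner ℝ (u z.2 - u z.1) (z.2 - z.1) / ‖z.2 - z.1‖)

/-- The increment quotient, as a function of the base point and the increment. -/
noncomputable def incrementQuotient (r : ℝ) (u : Pt d → Pt d) (z : Pt d × Pt d) : Pt d :=
  ‖z.2‖ ^ (-r) • (u (z.1 + z.2) - u z.1)

theorem measurable_gagliardoQuotient (r : ℝ) {u : Pt d → Pt d} (hu : Measurable u) :
    Measurable (gagliardoQuotient r u) := by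
  unfold gagliardoQuotient; fun_prop

theorem measurable_projectedQuotient (r : ℝ) {u : Pt d → Pt d} (hu : Measurable u) :
    Measurable (projectedQuotient r u) := by
  unfold projectedQuotient; fun_prop

theorem measurable_incrementQuotient (r : ℝ) {u : Pt d → Pt d} (hu : Measurable u) :
    Measurable (incrementQuotient r u) := by
  unfold incrementQuotient; fun_prop

theorem lintegral_lintegral_rpow_eq_eLpNorm {F : Type*} [NormedAddCommGroup F]
    [MeasurableSpace F] [BorelSpace F] {p : ℝ} (hp : 1 ≤ p) {D : Set (Pt d)}
    {g : Pt d × Pt d → F} (hg : Measurable g) :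
    (∫⁻ x in D, ∫⁻ y in D, ENNReal.ofReal (‖g (x, y)‖ ^ p)) ^ (1 / p) =
      eLpNorm g (ENNReal.ofReal p) ((volume.prod volume).restrict (D ×ˢ D)) := by
  have hp0 : 0 < p := by linarith
  rw [eLpNorm_eq_lintegral_rpow_enorm_toReal (by simpa using hp0) (by simp),
    ENNReal.toReal_ofReal hp0.le, setLIntegral_prod _ (by fun_prop)]
  congr 1
  refine lintegral_congr fun x => lintegral_congr fun y => ?_
  rw [← ofReal_norm, ENNReal.ofReal_rpow_of_nonneg (norm_nonneg _) hp0.le]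

theorem rpow_div_rpow_eq {a b p q r : ℝ} (ha : 0 ≤ a) (hb : 0 ≤ b) (hq : q = r * p) :
    a ^ p / b ^ q = (b ^ (-r) * a) ^ p := by
  rw [Real.mul_rpow (by positivity) ha, ← Real.rpow_mul hb, hq, div_eq_mul_inv,
    ← Real.rpow_neg hb, mul_comm]
  congr 2
  ring

/-- The order `n / p + s` of the quotients. -/
noncomputable def quotientOrder (d : ℕ) (s p : ℝ) : ℝ := ((d + 1 : ℕ) : ℝ) / p + s

theorem quotientOrder_pos {s p : ℝ} (hs : 0 < s) (hp : 1 ≤ p) : 0 < quotientOrder d s p := by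
  unfold quotientOrder; positivity

theorem exponent_eq_quotientOrder_mul {s p : ℝ} (hp : 1 ≤ p) :
    ((d + 1 : ℕ) : ℝ) + p * s = quotientOrder d s p * p := by
  have : p ≠ 0 := by linarith
  unfold quotientOrder
  field_simp

theorem sobolevSeminorm_eq_eLpNorm {s p : ℝ} (hp : 1 ≤ p) {D : Set (Pt d)}
    {u : Pt d → Pt d} (hu : Measurable u) :
    sobolevSeminorm s p D u = eLpNorm (gagliardoQuotient (quotientOrder d s p) u)
      (ENNReal.ofReal p) ((volume.prod volume).restrict (D ×ˢ D)) := by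
  rw [← lintegral_lintegral_rpow_eq_eLpNorm hp (measurable_gagliardoQuotient _ hu),
    sobolevSeminorm]
  simp only [gagliardoQuotient, norm_smul, Real.norm_eq_abs, abs_of_nonneg
    (Real.rpow_nonneg (norm_nonneg _) _),
    rpow_div_rpow_eq (norm_nonneg _) (norm_nonneg _) (exponent_eq_quotientOrder_mul hp)]

theorem projectedSeminorm_eq_eLpNorm {s p : ℝ} (hp : 1 ≤ p) {D : Set (Pt d)}
    {u : Pt d → Pt d} (hu : Measurable u) :
    projectedSeminorm s p D u = eLpNorm (projectedQuotient (quotientOrder d s p) u)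
      (ENNReal.ofReal p) ((volume.prod volume).restrict (D ×ˢ D)) := by
  rw [← lintegral_lintegral_rpow_eq_eLpNorm hp (measurable_projectedQuotient _ hu),
    projectedSeminorm]
  simp only [projectedQuotient, norm_mul, Real.norm_eq_abs, abs_of_nonneg
    (Real.rpow_nonneg (norm_nonneg _) _),
    rpow_div_rpow_eq (abs_nonneg _) (norm_nonneg _) (exponent_eq_quotientOrder_mul hp)]

theorem sobolevSeminorm_congr_ae {s p : ℝ} {D : Set (Pt d)} {u v : Pt d → Pt d}
    (h : u =ᵐ[volume.restrict D] v) : sobolevSeminorm s p D u = sobolevSeminorm s p D v := by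
  unfold sobolevSeminorm
  congr 1
  refine lintegral_congr_ae (h.mono fun x hx => lintegral_congr_ae (h.mono fun y hy => ?_))
  simp only [hx, hy]

theorem projectedSeminorm_congr_ae {s p : ℝ} {D : Set (Pt d)} {u v : Pt d → Pt d}
    (h : u =ᵐ[volume.restrict D] v) :
    projectedSeminorm s p D u = projectedSeminorm s p D v := by
  unfold projectedSeminorm
  congr 1
  refine lintegral_congr_ae (h.mono fun x hx => lintegral_congr_ae (h.mono fun y hy => ?_))
  simp only [hx, hy]

theorem projectedSeminorm_le_sobolevSeminorm {s p : ℝ} (hp : 1 ≤ p) (D : Set (Pt d))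
    (u : Pt d → Pt d) : projectedSeminorm s p D u ≤ sobolevSeminorm s p D u := by
  unfold projectedSeminorm sobolevSeminorm
  refine ENNReal.rpow_le_rpow ?_ (by positivity)
  refine lintegral_mono fun x => lintegral_mono fun y => ENNReal.ofReal_le_ofReal ?_
  rw [norm_sub_rev x y, norm_sub_rev (u x) (u y)]
  refine div_le_div_of_nonneg_right ?_ (by positivity)
  refine Real.rpow_le_rpow (abs_nonneg _) ?_ (by linarith)
  rw [abs_div, abs_norm]
  exact div_le_of_le_mul₀ (norm_nonneg _) (norm_nonneg _) (abs_real_inner_le_norm _ _)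

/-! ### Cones and linear substitutions -/

theorem horizontalPart_add (x y : Pt d) :
    horizontalPart (x + y) = horizontalPart x + horizontalPart y := by
  ext i; simp [horizontalPart]

theorem horizontalPart_smul (a : ℝ) (x : Pt d) :
    horizontalPart (a • x) = a • horizontalPart x := by
  ext i; simp [horizontalPart]

theorem horizontalPart_sub (x y : Pt d) :
    horizontalPart (x - y) = horizontalPart x - horizontalPart y := by
  ext i; simp [horizontalPart]

theorem horizontalPart_single_last (a : ℝ) :
    horizontalPart (EuclideanSpace.single (Fin.last d) a) = 0 := by
  ext i
  simp [horizontalPart]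

theorem continuous_horizontalPart : Continuous (horizontalPart (d := d)) := by
  unfold horizontalPart; fun_prop

theorem norm_sq_eq_horizontalPart (x : Pt d) :
    ‖x‖ ^ 2 = ‖horizontalPart x‖ ^ 2 + x (Fin.last d) ^ 2 := by
  simp [EuclideanSpace.norm_sq_eq, Fin.sum_univ_castSucc, horizontalPart]

theorem norm_horizontalPart_le (x : Pt d) : ‖horizontalPart x‖ ≤ ‖x‖ := by
  have := norm_sq_eq_horizontalPart x
  exact le_of_sq_le_sq (by nlinarith [sq_nonneg (x (Fin.last d))]) (norm_nonneg _)

theorem norm_le_horizontalPart_add (x : Pt d) :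
    ‖x‖ ≤ ‖horizontalPart x‖ + |x (Fin.last d)| := by
  refine abs_le_of_sq_le_sq' (?_ : _ ≤ _) (by positivity) |>.2
  have := norm_sq_eq_horizontalPart x
  nlinarith [norm_nonneg (horizontalPart x), abs_nonneg (x (Fin.last d)),
    sq_abs (x (Fin.last d)), mul_nonneg (norm_nonneg (horizontalPart x))
      (abs_nonneg (x (Fin.last d)))]

theorem abs_apply_le_norm (x : Pt d) (i : Fin (d + 1)) : |x i| ≤ ‖x‖ :=
  PiLp.norm_apply_le x i

theorem norm_le_sum_abs (x : Pt d) : ‖x‖ ≤ ∑ i, |x i| := by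
  conv_lhs => rw [← (EuclideanSpace.basisFun (Fin (d + 1)) ℝ).sum_repr x]
  refine (norm_sum_le _ _).trans (Finset.sum_le_sum fun i _ => ?_)
  simp [norm_smul]

/-- The open cone `{h : N |h'| < h_n}`. -/
def upCone (d : ℕ) (N : ℝ) : Set (Pt d) := {h | N * ‖horizontalPart h‖ < h (Fin.last d)}

theorem measurableSet_upCone (N : ℝ) : MeasurableSet (upCone d N) :=
  (isOpen_lt (by have := continuous_horizontalPart (d := d); fun_prop)
    (by fun_prop)).measurableSet

theorem last_pos_of_mem_upCone {N : ℝ} (hN : 0 ≤ N) {h : Pt d} (hh : h ∈ upCone d N) :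
    0 < h (Fin.last d) :=
  lt_of_le_of_lt (by positivity) hh

theorem ne_zero_of_mem_upCone {N : ℝ} (hN : 0 ≤ N) {h : Pt d} (hh : h ∈ upCone d N) :
    h ≠ 0 := by
  rintro rfl
  simpa using last_pos_of_mem_upCone hN hh

theorem upCone_anti {M N : ℝ} (h : M ≤ N) : upCone d N ⊆ upCone d M := fun _ hx =>
  lt_of_le_of_lt (mul_le_mul_of_nonneg_right h (norm_nonneg _)) hx

theorem smul_mem_upCone {N t : ℝ} (ht : 0 < t) {h : Pt d} (hh : h ∈ upCone d N) :
    t • h ∈ upCone d N := by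
  simp only [upCone, mem_ofPred_eq, horizontalPart_smul, norm_smul, Real.norm_eq_abs,
    abs_of_pos ht, PiLp.smul_apply, smul_eq_mul] at hh ⊢
  nlinarith

theorem norm_le_two_mul_last {N : ℝ} (hN : 1 ≤ N) {h : Pt d} (hh : h ∈ upCone d N) :
    ‖h‖ ≤ 2 * h (Fin.last d) := by
  have h1 := norm_le_horizontalPart_add h
  rw [abs_of_pos (last_pos_of_mem_upCone (by linarith) hh)] at h1
  have h2 : N * ‖horizontalPart h‖ < h (Fin.last d) := hh
  nlinarith [norm_nonneg (horizontalPart h)]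

/-- The linear map `h ↦ a h + b h_i e_j`. -/
noncomputable def rankOneAdd (a b : ℝ) (i j : Fin (d + 1)) : Pt d →ₗ[ℝ] Pt d where
  toFun h := a • h + EuclideanSpace.single j (b * h i)
  map_add' x y := by
    ext k
    by_cases hk : k = j <;> simp [hk] <;> ring
  map_smul' t x := by
    ext k
    by_cases hk : k = j <;> simp [hk] <;> ring

theorem rankOneAdd_apply (a b : ℝ) (i j : Fin (d + 1)) (h : Pt d) :
    rankOneAdd a b i j h = a • h + EuclideanSpace.single j (b * h i) := rfl

theorem rankOneAdd_injective {a b : ℝ} (ha : a ≠ 0) (hab : a + b ≠ 0) (i j : Fin (d + 1)) :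
    Function.Injective (rankOneAdd a b i j) := by
  refine (injective_iff_map_eq_zero _).2 fun h hh => ?_
  rw [rankOneAdd_apply] at hh
  have h0 : h i = 0 := by
    have := congrArg (fun x : Pt d => x i) hh
    by_cases hij : i = j
    · have h2 : (a + b) * h i = 0 := by
        rw [add_mul]; simpa [hij] using this
      exact (mul_eq_zero.1 h2).resolve_left hab
    · have h2 : a * h i = 0 := by simpa [hij] using this
      exact (mul_eq_zero.1 h2).resolve_left ha
  have hs : EuclideanSpace.single j (0 : ℝ) = (0 : Pt d) := by ext k; simp
  simpa [h0, ha, hs] using hh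

theorem norm_rankOneAdd_le (a b : ℝ) (i j : Fin (d + 1)) (h : Pt d) :
    ‖rankOneAdd a b i j h‖ ≤ (|a| + |b|) * ‖h‖ := by
  rw [rankOneAdd_apply]
  refine (norm_add_le _ _).trans ?_
  rw [norm_smul, PiLp.norm_single, norm_mul, Real.norm_eq_abs, Real.norm_eq_abs,
    Real.norm_eq_abs, add_mul]
  gcongr
  exact abs_apply_le_norm h i

theorem horizontalPart_rankOneAdd_last (a b : ℝ) (i : Fin (d + 1)) (h : Pt d) :
    horizontalPart (rankOneAdd a b i (Fin.last d) h) = a • horizontalPart h := by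
  rw [rankOneAdd_apply, horizontalPart_add, horizontalPart_smul, horizontalPart_single_last,
    add_zero]

/-- The linear map `(x, h) ↦ (x + L₁ h, x + L₂ h)`. -/
noncomputable def pairMap (L₁ L₂ : Pt d →ₗ[ℝ] Pt d) : Pt d × Pt d →ₗ[ℝ] Pt d × Pt d :=
  (LinearMap.fst ℝ _ _ + L₁ ∘ₗ LinearMap.snd ℝ _ _).prod
    (LinearMap.fst ℝ _ _ + L₂ ∘ₗ LinearMap.snd ℝ _ _)

theorem pairMap_apply (L₁ L₂ : Pt d →ₗ[ℝ] Pt d) (z : Pt d × Pt d) :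
    pairMap L₁ L₂ z = (z.1 + L₁ z.2, z.1 + L₂ z.2) := rfl

/-- Subtracting the two components leaves `(L₂ - L₁) h`, so only the edge vector matters. -/
theorem pairMap_injective {L₁ L₂ : Pt d →ₗ[ℝ] Pt d} (h : Function.Injective (L₂ - L₁)) :
    Function.Injective (pairMap L₁ L₂) := by
  refine (injective_iff_map_eq_zero _).2 fun z hz => ?_
  rw [pairMap_apply, Prod.mk_eq_zero] at hz
  have h2 : z.2 = 0 := by
    refine (injective_iff_map_eq_zero _).1 h _ ?_
    rw [LinearMap.sub_apply, ← add_sub_add_left_eq_sub _ _ z.1, hz.1, hz.2, sub_zero]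
  refine Prod.ext ?_ h2
  simpa [h2] using hz.1

theorem eLpNorm_le_sum_of_norm_le {α F G ι : Type*} [MeasurableSpace α] [NormedAddCommGroup F]
    [NormedAddCommGroup G] [Fintype ι] {μ : Measure α} {p : ℝ≥0∞} (hp : 1 ≤ p) {f : α → F}
    {g : ι → α → G} {C : ℝ} (hg : ∀ i, AEStronglyMeasurable (g i) μ)
    (h : ∀ᵐ z ∂μ, ‖f z‖ ≤ C * ∑ i, ‖g i z‖) :
    eLpNorm f p μ ≤ ENNReal.ofReal C * ∑ i, eLpNorm (g i) p μ := by
  have h1 : ∀ᵐ z ∂μ, ‖f z‖ ≤ C * ‖(∑ i, fun z => ‖g i z‖) z‖ := by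
    filter_upwards [h] with z hz
    rwa [Finset.sum_apply, Real.norm_of_nonneg (Finset.sum_nonneg fun i _ => norm_nonneg _)]
  refine (eLpNorm_le_mul_eLpNorm_of_ae_le_mul h1 p).trans ?_
  gcongr
  refine (eLpNorm_sum_le (fun i _ => (hg i).norm) hp).trans (le_of_eq ?_)
  exact Finset.sum_congr rfl fun i _ => eLpNorm_norm _

/-! ### The fractional Korn inequality on sets that absorb a cone -/

/-- The second difference quotient. -/
noncomputable def secondQuotient (r : ℝ) (u : Pt d → Pt d) (z : Pt d × Pt d) : Pt d :=
  ‖z.2‖ ^ (-r) • (u (z.1 + (2 : ℝ) • z.2) - (2 : ℝ) • u (z.1 + z.2) + u z.1)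

theorem measurable_secondQuotient (r : ℝ) {u : Pt d → Pt d} (hu : Measurable u) :
    Measurable (secondQuotient r u) := by
  unfold secondQuotient; fun_prop

/-- The projected difference along the edge from `x + L₁ h` to `x + L₂ h`, scaled by `h`. -/
noncomputable def edgeQuotient (r : ℝ) (u : Pt d → Pt d) (L : (Pt d →ₗ[ℝ] Pt d) × (Pt d →ₗ[ℝ] Pt d))
    (z : Pt d × Pt d) : ℝ :=
  ‖z.2‖ ^ (-r) * (inner ℝ (u (z.1 + L.2 z.2) - u (z.1 + L.1 z.2)) (L.2 z.2 - L.1 z.2) / ‖z.2‖)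

theorem measurable_edgeQuotient (r : ℝ) {u : Pt d → Pt d} (hu : Measurable u)
    (L : (Pt d →ₗ[ℝ] Pt d) × (Pt d →ₗ[ℝ] Pt d)) : Measurable (edgeQuotient r u L) := by
  have h1 : Measurable L.1 := L.1.continuous_of_finiteDimensional.measurable
  have h2 : Measurable L.2 := L.2.continuous_of_finiteDimensional.measurable
  unfold edgeQuotient; fun_prop

/-- Up to its weight, an edge quotient is the projected quotient after the linear substitution
`pairMap`. The weights use `‖h‖` and the edge length respectively, and the bound edge length `≤ K
‖h‖` compares them in the direction needed. -/
theorem exists_eLpNorm_edgeQuotient_le {r : ℝ} (hr : 0 ≤ r) {p : ℝ≥0∞} (hp : p ≠ ∞)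
    {L : (Pt d →ₗ[ℝ] Pt d) × (Pt d →ₗ[ℝ] Pt d)} (hL : Function.Injective (L.2 - L.1)) :
    ∃ c : ℝ≥0, ∀ D R : Set (Pt d), MeasurableSet D →
      (∀ x ∈ D, ∀ h ∈ R, x + L.1 h ∈ D ∧ x + L.2 h ∈ D) → ∀ u : Pt d → Pt d, Measurable u →
        eLpNorm (edgeQuotient r u L) p ((volume.prod volume).restrict (D ×ˢ R)) ≤
          c * eLpNorm (projectedQuotient r u) p ((volume.prod volume).restrict (D ×ˢ D)) := by
  obtain ⟨c, hc⟩ := exists_eLpNorm_comp_linearMap_le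
    (volume.prod volume : Measure (Pt d × Pt d)) (pairMap_injective hL) hp ℝ
  set B : Pt d →L[ℝ] Pt d := LinearMap.toContinuousLinearMap (L.2 - L.1) with hB
  -- The added 1 only secures `K > 0`.
  set K : ℝ := ‖B‖ + 1 with hK
  have hK0 : 0 < K := by positivity
  have hBK : ∀ h, ‖L.2 h - L.1 h‖ ≤ K * ‖h‖ := fun h => by
    have h1 : L.2 h - L.1 h = B h := rfl
    rw [h1]
    exact (B.le_opNorm h).trans (by rw [hK]; nlinarith [norm_nonneg h])
  refine ⟨(K ^ r * K).toNNReal * c, fun D R hD hDR u hu => ?_⟩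
  have h1 : ∀ z, ‖edgeQuotient r u L z‖ ≤
      (K ^ r * K) * ‖projectedQuotient r u (pairMap L.1 L.2 z)‖ := by
    intro z
    rcases eq_or_ne z.2 0 with hz | hz
    · simp only [edgeQuotient, hz, map_zero, norm_zero, div_zero, mul_zero]
      positivity
    have hb : 0 < ‖L.2 z.2 - L.1 z.2‖ := by
      rw [norm_pos_iff]
      intro h0
      exact hz ((injective_iff_map_eq_zero _).1 hL _ h0)
    have hz0 : 0 < ‖z.2‖ := norm_pos_iff.2 hz
    have e1 := rpow_neg_le_of_le_mul hb hK0 hr (hBK z.2)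
    have e2 : 1 / ‖z.2‖ ≤ K * (1 / ‖L.2 z.2 - L.1 z.2‖) := by
      rw [mul_one_div, div_le_div_iff₀ hz0 hb, one_mul]
      exact hBK z.2
    simp only [edgeQuotient, projectedQuotient, pairMap_apply, add_sub_add_left_eq_sub]
    simp only [norm_mul, norm_div, abs_norm, Real.norm_eq_abs,
      abs_of_nonneg (Real.rpow_nonneg (norm_nonneg _) _)]
    set I := |inner ℝ (u (z.1 + L.2 z.2) - u (z.1 + L.1 z.2)) (L.2 z.2 - L.1 z.2)|
    have hI : 0 ≤ I := abs_nonneg _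
    calc ‖z.2‖ ^ (-r) * (I / ‖z.2‖) = ‖z.2‖ ^ (-r) * (1 / ‖z.2‖) * I := by ring
      _ ≤ (K ^ r * ‖L.2 z.2 - L.1 z.2‖ ^ (-r)) * (K * (1 / ‖L.2 z.2 - L.1 z.2‖)) * I := by
        gcongr
      _ = _ := by ring
  refine (eLpNorm_le_mul_eLpNorm_of_ae_le_mul (ae_of_all _ h1) p).trans ?_
  rw [ENNReal.coe_mul, mul_assoc]
  refine mul_le_mul_right (hc _ _ (hD.prod hD) ?_ _
    (measurable_projectedQuotient r hu).stronglyMeasurable) _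
  exact fun z hz => ⟨(hDR _ hz.1 _ hz.2).1, (hDR _ hz.1 _ hz.2).2⟩

/-- The edges of the framework on `0, h, 2h, Bh, h + Bh` in whose stress the second difference
in direction `Bh` is resolved. -/
noncomputable def frameworkEdges (B : Pt d →ₗ[ℝ] Pt d) :
    Fin 7 → (Pt d →ₗ[ℝ] Pt d) × (Pt d →ₗ[ℝ] Pt d) :=
  let I : Pt d →ₗ[ℝ] Pt d := LinearMap.id
  ![(I, (2 : ℝ) • I), (I, I + B), (I + B, (2 : ℝ) • I), (0, B), (B, I), (B, I + B), (0, I)]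

/-- The seven edge vectors take only the values `h`, `Bh` and `h - Bh`. -/
theorem frameworkEdges_injective {B : Pt d →ₗ[ℝ] Pt d} (h1 : Function.Injective B)
    (h2 : Function.Injective ((LinearMap.id : Pt d →ₗ[ℝ] Pt d) - B)) (k : Fin 7) :
    Function.Injective ((frameworkEdges B k).2 - (frameworkEdges B k).1) := by
  have e1 : (2 : ℝ) • (LinearMap.id : Pt d →ₗ[ℝ] Pt d) - LinearMap.id = LinearMap.id := by
    rw [two_smul]; abel
  have e2 : (2 : ℝ) • (LinearMap.id : Pt d →ₗ[ℝ] Pt d) - (LinearMap.id + B) =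
    LinearMap.id - B := by rw [two_smul]; abel
  fin_cases k <;> simp only [frameworkEdges] <;> simp [e1, e2, h1, h2, Function.injective_id]

/-- Each term on the right pairs a difference of `u` along an edge with that same edge vector, so it
is a projected difference. The weights balance at the auxiliary vertices `a` and `h + a`, where `ua`
and `uh` cancel; at `0, h, 2h` they leave `a, -2a, a`. -/
theorem inner_second_difference_eq (u0 u1 u2 ua uh h a : Pt d) :
    inner ℝ (u2 - (2 : ℝ) • u1 + u0) a =
      inner ℝ (u2 - u1) h + inner ℝ (uh - u1) a - inner ℝ (u2 - uh) (h - a)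
        - inner ℝ (ua - u0) a + inner ℝ (u1 - ua) (h - a) - inner ℝ (uh - ua) h := by
  simp only [inner_sub_left, inner_sub_right, inner_add_left, real_inner_smul_left]
  ring

theorem inner_rankOneAdd_right (a b : ℝ) (i j : Fin (d + 1)) (w h : Pt d) :
    inner ℝ w (rankOneAdd a b i j h) = a * inner ℝ w h + b * h i * w j := by
  rw [rankOneAdd_apply, inner_add_right, real_inner_smul_right, EuclideanSpace.inner_single_right]
  simp

/-- With `Bh = h / 2 + θ h_n e_i`, testing the second difference `w` against `Bh` and subtracting
half of its test against `h` isolates `θ h_n w_i`. Both tests are combinations of projected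
differences along the edges. -/
theorem abs_second_difference_apply_le {θ : ℝ} (hθ : 0 < θ) (i : Fin (d + 1)) (u : Pt d → Pt d)
    (x h : Pt d) (hh : 0 < h (Fin.last d)) (r : ℝ) (hn : ‖h‖ ≤ 2 * h (Fin.last d)) :
    ‖h‖ ^ (-r) * |(u (x + (2 : ℝ) • h) - (2 : ℝ) • u (x + h) + u x) i| ≤
      2 / θ * ∑ k, ‖edgeQuotient r u
        (frameworkEdges (rankOneAdd (1 / 2) θ (Fin.last d) i) k) (x, h)‖ := by
  set B := rankOneAdd (1 / 2) θ (Fin.last d) i with hB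
  set w := u (x + (2 : ℝ) • h) - (2 : ℝ) • u (x + h) + u x with hw
  have hh0 : 0 < ‖h‖ := by
    rw [norm_pos_iff]; rintro rfl; simp at hh
  have e1 := inner_rankOneAdd_right (1 / 2) θ (Fin.last d) i w h
  rw [← hB, hw, inner_second_difference_eq _ _ _ (u (x + B h)) (u (x + (h + B h))) h (B h)] at e1
  rw [← hw] at e1
  have e2 : inner ℝ w h = inner ℝ (u (x + (2 : ℝ) • h) - u (x + h)) h
      - inner ℝ (u (x + h) - u x) h := by
    rw [hw]
    simp only [inner_sub_left, inner_add_left, real_inner_smul_left]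
    ring
  have e3 : (2 : ℝ) • h - h = h := by rw [two_smul]; abel
  have e4 : (2 : ℝ) • h - (h + B h) = h - B h := by rw [two_smul]; abel
  simp only [Fin.sum_univ_seven, edgeQuotient, frameworkEdges, Matrix.cons_val,
    LinearMap.id_apply, LinearMap.smul_apply, LinearMap.add_apply, LinearMap.zero_apply, e3, e4,
    add_zero, sub_zero, add_sub_cancel_left, add_sub_cancel_right, norm_mul, norm_div, abs_norm,
    Real.norm_eq_abs, abs_of_nonneg (Real.rpow_nonneg (norm_nonneg _) _)]
  set p1 := inner ℝ (u (x + (2 : ℝ) • h) - u (x + h)) h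
  set p2 := inner ℝ (u (x + (h + B h)) - u (x + h)) (B h)
  set p3 := inner ℝ (u (x + (2 : ℝ) • h) - u (x + (h + B h))) (h - B h)
  set p4 := inner ℝ (u (x + B h) - u x) (B h)
  set p5 := inner ℝ (u (x + h) - u (x + B h)) (h - B h)
  set p6 := inner ℝ (u (x + (h + B h)) - u (x + B h)) h
  set p7 := inner ℝ (u (x + h) - u x) h
  set S := |p1| + |p2| + |p3| + |p4| + |p5| + |p6| + |p7| with hS
  have e5 : θ * h (Fin.last d) * |w i| ≤ S := by
    have e6 : θ * h (Fin.last d) * w i = p1 / 2 + p2 - p3 - p4 + p5 - p6 + p7 / 2 := by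
      rw [e2] at e1; linarith
    rw [← abs_of_pos (mul_pos hθ hh), ← abs_mul, e6]
    refine abs_le.2 ⟨?_, ?_⟩ <;>
    linarith [abs_nonneg p1, abs_nonneg p7, le_abs_self p1, le_abs_self p2, le_abs_self p3,
      le_abs_self p4, le_abs_self p5, le_abs_self p6, le_abs_self p7, neg_abs_le p1,
      neg_abs_le p2, neg_abs_le p3, neg_abs_le p4, neg_abs_le p5, neg_abs_le p6, neg_abs_le p7]
  -- In the cone `h_n` is comparable to `‖h‖`, which allows division by `‖h‖` instead of `h_n`.
  have e7 : |w i| ≤ 2 / θ * (S / ‖h‖) := by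
    rw [div_mul_div_comm, le_div_iff₀ (by positivity)]
    nlinarith [mul_le_mul_of_nonneg_left hn (mul_nonneg hθ.le (abs_nonneg (w i)))]
  calc ‖h‖ ^ (-r) * |w i| ≤ ‖h‖ ^ (-r) * (2 / θ * (S / ‖h‖)) := by gcongr
    _ = _ := by rw [hS]; ring

theorem norm_secondQuotient_le {θ : ℝ} (hθ : 0 < θ) (u : Pt d → Pt d) (z : Pt d × Pt d)
    (hh : 0 < z.2 (Fin.last d)) (r : ℝ) (hn : ‖z.2‖ ≤ 2 * z.2 (Fin.last d)) :
    ‖secondQuotient r u z‖ ≤ 2 / θ * ∑ j : Fin (d + 1) × Fin 7, ‖edgeQuotient r u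
        (frameworkEdges (rankOneAdd (1 / 2) θ (Fin.last d) j.1) j.2) z‖ := by
  rw [secondQuotient, norm_smul, Real.norm_of_nonneg (Real.rpow_nonneg (norm_nonneg _) _),
    Fintype.sum_prod_type, Finset.mul_sum]
  refine (mul_le_mul_of_nonneg_left (norm_le_sum_abs _)
    (Real.rpow_nonneg (norm_nonneg _) _)).trans ?_
  rw [Finset.mul_sum]
  exact Finset.sum_le_sum fun i _ => abs_second_difference_apply_le hθ i u z.1 z.2 hh r hn

/-- Adding `θ h_n e_i` to `h / 2` costs at most `M θ h_n ≤ h_n / 4` in the cone condition, and `M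
‖h'‖ / 2 ≤ h_n / 8` by the narrower cone; the last coordinate remains at least `h_n / 2`. -/
theorem rankOneAdd_mem_upCone {M θ : ℝ} (hM : 0 ≤ M) (hθ0 : 0 < θ)
    (hθM : θ * (4 * (M + 1)) = 1) (i : Fin (d + 1)) {h : Pt d}
    (hh : h ∈ upCone d (4 * (M + 1))) :
    rankOneAdd (1 / 2) θ (Fin.last d) i h ∈ upCone d M := by
  have h0 : 0 < h (Fin.last d) := last_pos_of_mem_upCone (by positivity) hh
  have h1 : 4 * (M + 1) * ‖horizontalPart h‖ < h (Fin.last d) := hh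
  have h2 : 1 / 2 * h (Fin.last d) ≤ rankOneAdd (1 / 2) θ (Fin.last d) i h (Fin.last d) := by
    rw [rankOneAdd_apply]
    by_cases hi : Fin.last d = i
    · simp [← hi]; positivity
    · simp [hi]
  have h3 : ‖horizontalPart (rankOneAdd (1 / 2) θ (Fin.last d) i h)‖ ≤
      1 / 2 * ‖horizontalPart h‖ + θ * h (Fin.last d) := by
    rw [rankOneAdd_apply, horizontalPart_add, horizontalPart_smul]
    refine (norm_add_le _ _).trans (add_le_add (by simp [norm_smul]) ?_)
    refine (norm_horizontalPart_le _).trans ?_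
    rw [PiLp.norm_single, norm_mul, Real.norm_of_nonneg hθ0.le, Real.norm_of_nonneg h0.le]
  refine lt_of_lt_of_le ?_ h2
  have h4 : M * (θ * h (Fin.last d)) ≤ 1 / 4 * h (Fin.last d) := by nlinarith
  have h5 := mul_le_mul_of_nonneg_left h3 hM
  nlinarith [norm_nonneg (horizontalPart h)]

theorem add_frameworkEdges_mem {B : Pt d →ₗ[ℝ] Pt d} {D : Set (Pt d)} {x h : Pt d} (m0 : x ∈ D)
    (m1 : x + h ∈ D) (m2 : x + (2 : ℝ) • h ∈ D) (m3 : x + B h ∈ D) (m4 : x + (h + B h) ∈ D)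
    (k : Fin 7) : x + (frameworkEdges B k).1 h ∈ D ∧ x + (frameworkEdges B k).2 h ∈ D := by
  fin_cases k <;> simp only [frameworkEdges] <;> simp [m0, m1, m2, m3, m4]

/-- The edge vector `h - Bh` has the same form as `Bh` with `θ` reversed, so one injectivity
criterion serves both. -/
theorem id_sub_rankOneAdd (θ : ℝ) (i j : Fin (d + 1)) :
    (LinearMap.id : Pt d →ₗ[ℝ] Pt d) - rankOneAdd (1 / 2) θ i j =
      rankOneAdd (1 / 2) (-θ) i j := by
  ext h k
  by_cases hk : k = j <;> simp [rankOneAdd_apply, hk] <;> ring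

/-- The second difference quotient on a cone is controlled by the projected difference
quotient. -/
theorem exists_eLpNorm_secondQuotient_le (d : ℕ) {r : ℝ} (hr : 0 ≤ r) {p : ℝ≥0∞} (hp1 : 1 ≤ p)
    (hp : p ≠ ∞) {M : ℝ} (hM : 0 ≤ M) :
    ∃ c : ℝ≥0, ∀ D : Set (Pt d), MeasurableSet D → (∀ x ∈ D, ∀ h ∈ upCone d M, x + h ∈ D) →
      ∀ u : Pt d → Pt d, Measurable u →
        eLpNorm (secondQuotient r u) p
            ((volume.prod volume).restrict (D ×ˢ upCone d (4 * (M + 1)))) ≤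
          c * eLpNorm (projectedQuotient r u) p ((volume.prod volume).restrict (D ×ˢ D)) := by
  -- This size keeps `Bh` in the cone of slope `M`, and gives `θ ≤ 1 / 4`, so that `1 / 2 - θ ≠ 0`
  -- and `id - B` is injective.
  obtain ⟨θ, hθ0, hθM⟩ : ∃ θ : ℝ, 0 < θ ∧ θ * (4 * (M + 1)) = 1 :=
    ⟨1 / (4 * (M + 1)), by positivity, by field_simp⟩
  have hθ1 : θ ≤ 1 / 4 := by nlinarith
  have hinj : ∀ j : Fin (d + 1) × Fin 7, Function.Injective
      ((frameworkEdges (rankOneAdd (1 / 2) θ (Fin.last d) j.1) j.2).2 -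
        (frameworkEdges (rankOneAdd (1 / 2) θ (Fin.last d) j.1) j.2).1) := by
    intro j
    refine frameworkEdges_injective
      (rankOneAdd_injective (by norm_num) (by positivity) _ _) ?_ j.2
    rw [id_sub_rankOneAdd]
    exact rankOneAdd_injective (by norm_num) (by linarith) _ _
  choose c hc using fun j => exists_eLpNorm_edgeQuotient_le hr hp (hinj j)
  refine ⟨(2 / θ).toNNReal * ∑ j, c j, fun D hD hDM u hu => ?_⟩
  have hsub : upCone d (4 * (M + 1)) ⊆ upCone d M := upCone_anti (by linarith)
  have hS : MeasurableSet (D ×ˢ upCone d (4 * (M + 1))) := hD.prod (measurableSet_upCone _)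
  have hpt : ∀ᵐ z ∂(volume.prod volume).restrict (D ×ˢ upCone d (4 * (M + 1))),
      ‖secondQuotient r u z‖ ≤ 2 / θ * ∑ j : Fin (d + 1) × Fin 7, ‖edgeQuotient r u
        (frameworkEdges (rankOneAdd (1 / 2) θ (Fin.last d) j.1) j.2) z‖ :=
    (ae_restrict_mem hS).mono fun z hz => norm_secondQuotient_le hθ0 u z
      (last_pos_of_mem_upCone (by positivity) hz.2) r (norm_le_two_mul_last (by linarith) hz.2)
  refine (eLpNorm_le_sum_of_norm_le hp1
    (fun j => (measurable_edgeQuotient r hu _).aestronglyMeasurable) hpt).trans ?_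
  rw [ENNReal.coe_mul, mul_assoc, ENNReal.ofNNReal_toNNReal, ENNReal.ofNNReal_finsetSum,
    Finset.sum_mul]
  refine mul_le_mul_right (Finset.sum_le_sum fun j _ => ?_) _
  refine hc j D _ hD (fun x hx h hh => ?_) u hu
  have hB := rankOneAdd_mem_upCone hM hθ0 hθM j.1 hh
  have m1 : x + h ∈ D := hDM _ hx _ (hsub hh)
  refine add_frameworkEdges_mem hx m1 (hDM _ hx _ (smul_mem_upCone (by norm_num) (hsub hh)))
    (hDM _ hx _ hB) ?_ j.2
  -- The vertex `x + h + Bh` is reached by two successive cone steps.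
  rw [← add_assoc]
  exact hDM _ m1 _ hB

/-! ### From second to first differences -/

theorem ENNReal.le_ofReal_mul_of_le_mul_add {X Y : ℝ≥0∞} {a b : ℝ} (ha0 : 0 ≤ a) (ha : a < 1)
    (hb : 0 < b) (hX : X ≠ ∞) (h : X ≤ ENNReal.ofReal a * X + ENNReal.ofReal b * Y) :
    X ≤ ENNReal.ofReal (b / (1 - a)) * Y := by
  have h1 : 0 < b / (1 - a) := div_pos hb (by linarith)
  rcases eq_or_ne Y ∞ with hYt | hYt
  · rw [hYt, ENNReal.mul_top (by simpa using h1)]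
    exact le_top
  lift X to ℝ≥0 using hX
  lift Y to ℝ≥0 using hYt
  have h5 : (X : ℝ) ≤ a * X + b * Y := by
    have := ENNReal.toReal_mono (by finiteness) h
    rwa [ENNReal.toReal_add (by finiteness) (by finiteness), ENNReal.toReal_mul,
      ENNReal.toReal_mul, ENNReal.toReal_ofReal ha0,
      ENNReal.toReal_ofReal hb.le, ENNReal.coe_toReal, ENNReal.coe_toReal] at this
  rw [← ENNReal.ofReal_coe_nnreal, ← ENNReal.ofReal_coe_nnreal, ← ENNReal.ofReal_mul h1.le]
  refine ENNReal.ofReal_le_ofReal ?_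
  rw [div_mul_eq_mul_div, le_div_iff₀ (by linarith)]
  nlinarith

/-- The doubling of the increment scales the `L^p` norm of the increment quotient by `2 ^ s`,
which lets one pass from second to first differences. -/
theorem eLpNorm_incrementQuotient_le {s p : ℝ} (hs : 0 < s) (hs1 : s < 1) (hp : 1 ≤ p)
    {D : Set (Pt d)} (hD : MeasurableSet D) {N : ℝ} {u : Pt d → Pt d} (hu : Measurable u)
    (hfin : eLpNorm (incrementQuotient (quotientOrder d s p) u) (ENNReal.ofReal p)
      ((volume.prod volume).restrict (D ×ˢ upCone d N)) ≠ ∞) :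
    eLpNorm (incrementQuotient (quotientOrder d s p) u) (ENNReal.ofReal p)
      ((volume.prod volume).restrict (D ×ˢ upCone d N)) ≤
    ENNReal.ofReal (1 / 2 / (1 - 2 ^ (s - 1))) *
      eLpNorm (secondQuotient (quotientOrder d s p) u) (ENNReal.ofReal p)
      ((volume.prod volume).restrict (D ×ˢ upCone d N)) := by
  set r := quotientOrder d s p with hr
  set μ := ((volume.prod volume).restrict (D ×ˢ upCone d N) : Measure (Pt d × Pt d)) with hμ
  have hp0 : 0 < p := by linarith
  have hp1 : 1 ≤ ENNReal.ofReal p := by simpa using hp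
  set T : Pt d × Pt d →ₗ[ℝ] Pt d × Pt d :=
    LinearMap.prodMap LinearMap.id ((2 : ℝ) • LinearMap.id) with hT
  have hTz : ∀ z, T z = (z.1, (2 : ℝ) • z.2) := fun z => rfl
  have hTinj : Function.Injective T := by
    intro z w hzw
    rw [hTz, hTz, Prod.mk.injEq] at hzw
    exact Prod.ext hzw.1 (smul_right_injective _ (two_ne_zero (α := ℝ)) hzw.2)
  have hdet : LinearMap.det T = 2 ^ (d + 1) := by
    rw [hT, LinearMap.det_prodMap]
    simp
  have hmaps : MapsTo T (D ×ˢ upCone d N) (D ×ˢ upCone d N) := fun z hz =>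
    ⟨hz.1, smul_mem_upCone (by norm_num) hz.2⟩
  have h1 := eLpNorm_comp_linearMap_le (volume.prod volume : Measure (Pt d × Pt d)) hTinj
    (hD.prod (measurableSet_upCone N)) hmaps (p := ENNReal.ofReal p) (by simp)
    (measurable_incrementQuotient r hu).stronglyMeasurable
  rw [← hμ, hdet] at h1
  set X := eLpNorm (incrementQuotient r u) (ENNReal.ofReal p) μ with hX
  set Y := eLpNorm (secondQuotient r u) (ENNReal.ofReal p) μ with hY
  -- This is `u(x + h) - u(x) = (u(x + 2h) - u(x)) / 2 - (second difference) / 2`; doubling `h`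
  -- multiplies the weight by `2 ^ (-r)`, whence the factor `2 ^ (r - 1)`.
  have h2 : incrementQuotient r u = (2 ^ (r - 1) : ℝ) • (fun z => incrementQuotient r u (T z)) +
      (-(1 / 2) : ℝ) • secondQuotient r u := by
    funext z
    have e1 : ‖(2 : ℝ) • z.2‖ ^ (-r) = 2 ^ (-r) * ‖z.2‖ ^ (-r) := by
      rw [norm_smul, Real.norm_two, Real.mul_rpow (by norm_num) (norm_nonneg _)]
    have e2 : (2 : ℝ) ^ (r - 1) * 2 ^ (-r) = 1 / 2 := by
      rw [← Real.rpow_add two_pos, show r - 1 + -r = -1 by ring, Real.rpow_neg_one]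
      norm_num
    simp only [Pi.add_apply, Pi.smul_apply, incrementQuotient, secondQuotient, hTz, e1, smul_smul]
    rw [← mul_assoc, e2]
    module
  have h3 : X ≤ ENNReal.ofReal (2 ^ (s - 1)) * X + ENNReal.ofReal (1 / 2) * Y := by
    have hmT : Measurable T := T.continuous_of_finiteDimensional.measurable
    have h4 : X ≤ ENNReal.ofReal (2 ^ (r - 1)) * eLpNorm (fun z => incrementQuotient r u (T z))
        (ENNReal.ofReal p) μ + ENNReal.ofReal (1 / 2) * Y := by
      conv_lhs => rw [hX, h2]
      refine (eLpNorm_add_le ?_ ?_ hp1).trans (add_le_add ?_ ?_)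
      · exact (((measurable_incrementQuotient r hu).comp hmT).const_smul _).aestronglyMeasurable
      · exact ((measurable_secondQuotient r hu).const_smul _).aestronglyMeasurable
      · refine eLpNorm_const_smul_le.trans (le_of_eq ?_)
        rw [← ofReal_norm, Real.norm_of_nonneg (by positivity)]
      · refine eLpNorm_const_smul_le.trans (le_of_eq ?_)
        rw [← ofReal_norm, norm_neg, Real.norm_of_nonneg (by positivity)]
    -- The Jacobian of the doubling contributes `2 ^ (-n / p)`, and `r = n / p + s` leaves exactly
    -- `2 ^ (s - 1)`, which is less than 1 because `s < 1`.
    refine h4.trans (add_le_add_left ((mul_le_mul_right h1 _).trans (le_of_eq ?_)) _)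
    rw [← mul_assoc]
    congr 1
    rw [abs_of_pos (by positivity), ENNReal.ofReal_rpow_of_pos (by positivity),
      ← ENNReal.ofReal_mul (by positivity)]
    congr 1
    rw [ENNReal.toReal_div, ENNReal.toReal_one, ENNReal.toReal_ofReal hp0.le,
      ← Real.rpow_natCast, ← Real.rpow_neg two_pos.le, ← Real.rpow_mul two_pos.le,
      ← Real.rpow_add two_pos, hr, quotientOrder]
    congr 1
    ring
  have ha : (2 : ℝ) ^ (s - 1) < 1 := Real.rpow_lt_one_of_one_lt_of_neg one_lt_two (by linarith)
  exact ENNReal.le_ofReal_mul_of_le_mul_add (by positivity) ha (by norm_num) hfin h3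

/-- This supplies the a priori finiteness without which the absorption step would be void. -/
theorem exists_eLpNorm_incrementQuotient_le_gagliardoQuotient (d : ℕ) {r : ℝ} {p : ℝ≥0∞}
    (hp : p ≠ ∞) (M N : ℝ) (hMN : M ≤ N) :
    ∃ c : ℝ≥0, ∀ D : Set (Pt d), MeasurableSet D → (∀ x ∈ D, ∀ h ∈ upCone d M, x + h ∈ D) →
      ∀ u : Pt d → Pt d, Measurable u →
        eLpNorm (incrementQuotient r u) p ((volume.prod volume).restrict (D ×ˢ upCone d N)) ≤
          c * eLpNorm (gagliardoQuotient r u) p ((volume.prod volume).restrict (D ×ˢ D)) := by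
  obtain ⟨c, hc⟩ := exists_eLpNorm_comp_linearMap_le
    (volume.prod volume : Measure (Pt d × Pt d))
    (pairMap_injective (L₁ := LinearMap.id) (L₂ := 0) (by
      rw [zero_sub]; exact fun x y h => neg_injective h)) hp (Pt d)
  refine ⟨c, fun D hD hDM u hu => ?_⟩
  have h1 : incrementQuotient r u =
      fun z => gagliardoQuotient r u (pairMap LinearMap.id 0 z) := by
    funext z
    simp [incrementQuotient, gagliardoQuotient, pairMap_apply]
  rw [h1]
  refine hc _ _ (hD.prod hD) (fun z hz => ⟨hDM _ hz.1 _ (upCone_anti hMN hz.2), ?_⟩) _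
    (measurable_gagliardoQuotient r hu).stronglyMeasurable
  simpa [pairMap_apply] using hz.1

/-! ### From increments in a cone to all pairs of points -/

/-- The sign attached to a Boolean. -/
def boolSign (b : Bool) : ℝ := if b then 1 else -1

/-- The substitution `(x, y) ↦ (x, v / 2 + b v_i e_n)`, `v = y - x`, or its mirror image
`(x, y) ↦ (y, - v / 2 + b v_i e_n)`. -/
noncomputable def apexMap (b : ℝ) (i : Fin (d + 1)) (τ : Bool) :
    Pt d × Pt d →ₗ[ℝ] Pt d × Pt d :=
  LinearMap.prod (if τ then LinearMap.fst ℝ _ _ else LinearMap.snd ℝ _ _)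
    (rankOneAdd (boolSign τ / 2) b i (Fin.last d) ∘ₗ (LinearMap.snd ℝ _ _ - LinearMap.fst ℝ _ _))

theorem apexMap_apply (b : ℝ) (i : Fin (d + 1)) (τ : Bool) (z : Pt d × Pt d) :
    apexMap b i τ z = (if τ then z.1 else z.2,
      rankOneAdd (boolSign τ / 2) b i (Fin.last d) (z.2 - z.1)) := by
  cases τ <;> rfl

/-- The substitution could degenerate only if `± 1 / 2 + b = 0`, in the case where `e_i` is the
vertical direction; `|b| ≥ 1` excludes this. -/
theorem apexMap_injective {b : ℝ} (hb : 1 ≤ |b|) (i : Fin (d + 1)) (τ : Bool) :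
    Function.Injective (apexMap b i τ) := by
  refine (injective_iff_map_eq_zero _).2 fun z hz => ?_
  rw [apexMap_apply, Prod.mk_eq_zero] at hz
  have h1 : z.2 - z.1 = 0 := by
    refine (injective_iff_map_eq_zero _).1 (rankOneAdd_injective ?_ ?_ i (Fin.last d)) _ hz.2
    · cases τ <;> norm_num [boolSign]
    · intro h
      rw [eq_neg_of_add_eq_zero_right h] at hb
      cases τ <;> norm_num [boolSign, abs_of_pos] at hb
  cases τ
  · have h2 : z.2 = 0 := by simpa using hz.1
    exact Prod.ext (by simpa [h2] using h1) h2
  · have h2 : z.1 = 0 := by simpa using hz.1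
    exact Prod.ext h2 (by simpa [h2] using h1)

/-- The vertical shift `R t v_i` is at least `(N + 1) ‖v‖`, so it outweighs both the vertical part
of `± v / 2` and `N` times its horizontal part. -/
theorem rankOneAdd_sign_mem_upCone {N R t : ℝ} (hN : 0 ≤ N) (hR : R = (d + 1 : ℕ) * (N + 1))
    {i : Fin (d + 1)} {v : Pt d} (hv : v ≠ 0) (hvi : ‖v‖ ≤ (d + 1 : ℕ) * (t * v i)) (τ : Bool) :
    rankOneAdd (boolSign τ / 2) (R * t) i (Fin.last d) v ∈ upCone d N := by
  have hτ : |boolSign τ / 2| = 1 / 2 := by cases τ <;> norm_num [boolSign, abs_div]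
  have hv0 : 0 < ‖v‖ := norm_pos_iff.2 hv
  simp only [upCone, mem_ofPred_eq, horizontalPart_rankOneAdd_last, norm_smul, Real.norm_eq_abs, hτ]
  have h1 : rankOneAdd (boolSign τ / 2) (R * t) i (Fin.last d) v (Fin.last d) =
      boolSign τ / 2 * v (Fin.last d) + R * t * v i := by
    rw [rankOneAdd_apply]; simp
  have h2 : -(1 / 2 * ‖v‖) ≤ boolSign τ / 2 * v (Fin.last d) := by
    refine le_trans ?_ (neg_abs_le _)
    rw [abs_mul, hτ]
    have := abs_apply_le_norm v (Fin.last d)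
    linarith
  have h3 : (N + 1) * ‖v‖ ≤ R * t * v i := by
    rw [hR]; nlinarith
  have h4 : N * (1 / 2 * ‖horizontalPart v‖) ≤ N * (1 / 2 * ‖v‖) := by
    have := norm_horizontalPart_le v
    gcongr
  rw [h1]
  nlinarith

theorem exists_norm_le_mul_apply (v : Pt d) :
    ∃ (i : Fin (d + 1)) (σ : Bool), ‖v‖ ≤ (d + 1 : ℕ) * (boolSign σ * v i) := by
  obtain ⟨i, -, hi⟩ := Finset.exists_max_image Finset.univ (fun i => |v i|) Finset.univ_nonempty
  have h1 : ‖v‖ ≤ (d + 1 : ℕ) * |v i| := by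
    refine (norm_le_sum_abs v).trans ?_
    refine (Finset.sum_le_card_nsmul _ _ _ fun j hj => hi j hj).trans (le_of_eq ?_)
    simp
  rcases le_total 0 (v i) with h | h
  · exact ⟨i, true, by simpa [boolSign, abs_of_nonneg h] using h1⟩
  · exact ⟨i, false, by simpa [boolSign, abs_of_nonpos h] using h1⟩

/-- The pairs of distinct points of `D` whose difference is dominated by its `i`-th coordinate. -/
def coordinateSector (D : Set (Pt d)) (i : Fin (d + 1)) (σ : Bool) : Set (Pt d × Pt d) :=
  {z | z ∈ D ×ˢ D ∧ z.2 - z.1 ≠ 0 ∧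
    ‖z.2 - z.1‖ ≤ (d + 1 : ℕ) * (boolSign σ * (z.2 - z.1) i)}

theorem measurableSet_coordinateSector {D : Set (Pt d)} (hD : MeasurableSet D)
    (i : Fin (d + 1)) (σ : Bool) : MeasurableSet (coordinateSector D i σ) := by
  refine (hD.prod hD).inter (MeasurableSet.inter ?_ ?_)
  · exact (isOpen_ne_fun (f := fun z : Pt d × Pt d => z.2 - z.1) (g := fun _ => 0)
      (by fun_prop) (by fun_prop)).measurableSet
  · exact (isClosed_le (f := fun z : Pt d × Pt d => ‖z.2 - z.1‖)
      (g := fun z => ((d + 1 : ℕ) : ℝ) * (boolSign σ * (z.2 - z.1) i))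
      (by fun_prop) (by fun_prop)).measurableSet

/-- The points `z.1` and `z.2` have the common apex `(z.1 + z.2) / 2 + R |v_i| e_n`, reached from
each by an increment in the cone. The triangle inequality through the apex gives the two terms, and
each increment has length at most `(1 / 2 + R) ‖v‖`. -/
theorem norm_gagliardoQuotient_le {r R : ℝ} (hr : 0 ≤ r) {σ : Bool} {i : Fin (d + 1)}
    {N : ℝ} (hN : 0 ≤ N) (hR : R = (d + 1 : ℕ) * (N + 1)) (u : Pt d → Pt d)
    {z : Pt d × Pt d} (hz : z.2 - z.1 ≠ 0)
    (hzi : ‖z.2 - z.1‖ ≤ (d + 1 : ℕ) * (boolSign σ * (z.2 - z.1) i)) :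
    ‖gagliardoQuotient r u z‖ ≤ (1 / 2 + R) ^ r *
      ∑ τ, ‖incrementQuotient r u (apexMap (R * boolSign σ) i τ z)‖ := by
  set v := z.2 - z.1 with hv
  set A : Bool → Pt d := fun τ => rankOneAdd (boolSign τ / 2) (R * boolSign σ) i (Fin.last d) v
    with hA
  have hR0 : 0 ≤ R := by rw [hR]; positivity
  have hw : ∀ τ, ‖v‖ ^ (-r) ≤ (1 / 2 + R) ^ r * ‖A τ‖ ^ (-r) := by
    intro τ
    refine rpow_neg_le_of_le_mul (norm_pos_iff.2 ?_) (by positivity) hr ?_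
    · exact ne_zero_of_mem_upCone hN (rankOneAdd_sign_mem_upCone hN hR hz hzi τ)
    · refine (norm_rankOneAdd_le _ _ _ _ _).trans (le_of_eq ?_)
      congr 2
      · cases τ <;> norm_num [boolSign, abs_div]
      · rw [abs_mul, abs_of_nonneg hR0]
        cases σ <;> simp [boolSign]
  have hapex : z.2 + A false = z.1 + A true := by
    simp only [hA, rankOneAdd_apply, boolSign, hv]
    norm_num
    module
  have hd : u z.1 - u z.2 = (u (z.2 + A false) - u z.2) - (u (z.1 + A true) - u z.1) := by
    rw [hapex]; abel
  rw [Fintype.sum_bool]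
  simp only [gagliardoQuotient, incrementQuotient, apexMap_apply, norm_smul, ← hv,
    Real.norm_of_nonneg (Real.rpow_nonneg (norm_nonneg _) _), norm_sub_rev z.1 z.2]
  simp only [if_true, Bool.false_eq_true, if_false]
  change ‖v‖ ^ (-r) * ‖u z.1 - u z.2‖ ≤ (1 / 2 + R) ^ r *
    (‖A true‖ ^ (-r) * ‖u (z.1 + A true) - u z.1‖ + ‖A false‖ ^ (-r) * ‖u (z.2 + A false) - u z.2‖)
  have h1 : ‖u z.1 - u z.2‖ ≤ ‖u (z.1 + A true) - u z.1‖ + ‖u (z.2 + A false) - u z.2‖ := by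
    rw [hd]; exact (norm_sub_le _ _).trans (add_comm _ _).le
  calc ‖v‖ ^ (-r) * ‖u z.1 - u z.2‖
      ≤ ‖v‖ ^ (-r) * (‖u (z.1 + A true) - u z.1‖ + ‖u (z.2 + A false) - u z.2‖) := by gcongr
    _ = ‖v‖ ^ (-r) * ‖u (z.1 + A true) - u z.1‖ + ‖v‖ ^ (-r) * ‖u (z.2 + A false) - u z.2‖ := by
      ring
    _ ≤ ((1 / 2 + R) ^ r * ‖A true‖ ^ (-r)) * ‖u (z.1 + A true) - u z.1‖ +
        ((1 / 2 + R) ^ r * ‖A false‖ ^ (-r)) * ‖u (z.2 + A false) - u z.2‖ := by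
      gcongr
      · exact hw true
      · exact hw false
    _ = _ := by ring

/-- The increments in a cone control all the differences. -/
theorem exists_eLpNorm_gagliardoQuotient_le (d : ℕ) {r : ℝ} (hr : 0 ≤ r) {p : ℝ≥0∞}
    (hp1 : 1 ≤ p) (hp : p ≠ ∞) {N : ℝ} (hN : 0 ≤ N) :
    ∃ c : ℝ≥0, ∀ D : Set (Pt d), MeasurableSet D → ∀ u : Pt d → Pt d, Measurable u →
      eLpNorm (gagliardoQuotient r u) p ((volume.prod volume).restrict (D ×ˢ D)) ≤
        c * eLpNorm (incrementQuotient r u) p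
          ((volume.prod volume).restrict (D ×ˢ upCone d N)) := by
  obtain ⟨R, hR⟩ : ∃ R : ℝ, R = (d + 1 : ℕ) * (N + 1) := ⟨_, rfl⟩
  have hR1 : 1 ≤ R := by
    rw [hR]
    have : (1 : ℝ) ≤ (d + 1 : ℕ) := by simp
    nlinarith
  have hinj : ∀ j : Fin (d + 1) × Bool × Bool,
      Function.Injective (apexMap (R * boolSign j.2.1) j.1 j.2.2) := fun j => by
    refine apexMap_injective ?_ _ _
    rw [abs_mul, abs_of_pos (by linarith)]
    rcases j with ⟨i, σ, τ⟩
    cases σ <;> simpa [boolSign] using hR1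
  choose c hc using fun j => exists_eLpNorm_comp_linearMap_le
    (volume.prod volume : Measure (Pt d × Pt d)) (hinj j) hp (Pt d)
  refine ⟨((1 / 2 + R) ^ r).toNNReal * ∑ j, c j, fun D hD u hu => ?_⟩
  have hm : ∀ j : Fin (d + 1) × Bool × Bool, Measurable fun z =>
      incrementQuotient r u (apexMap (R * boolSign j.2.1) j.1 j.2.2 z) := fun j =>
    (measurable_incrementQuotient r hu).comp
      (LinearMap.continuous_of_finiteDimensional _).measurable
  -- The dominant coordinate and its sign vary with `z`, so the sum runs over all choices. The
  -- indicators confine each substitution to the sector where it maps into `D ×ˢ upCone d N`.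
  have hpt : ∀ᵐ z ∂(volume.prod volume).restrict (D ×ˢ D), ‖gagliardoQuotient r u z‖ ≤
      (1 / 2 + R) ^ r * ∑ j : Fin (d + 1) × Bool × Bool,
        ‖(coordinateSector D j.1 j.2.1).indicator (fun z =>
          incrementQuotient r u (apexMap (R * boolSign j.2.1) j.1 j.2.2 z)) z‖ := by
    filter_upwards [ae_restrict_mem (hD.prod hD)] with z hzD
    rcases eq_or_ne (z.2 - z.1) 0 with hz | hz
    · rw [gagliardoQuotient, sub_eq_zero.1 hz, sub_self (u z.1), smul_zero, norm_zero]
      positivity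
    obtain ⟨i, σ, hi⟩ := exists_norm_le_mul_apply (z.2 - z.1)
    refine (norm_gagliardoQuotient_le hr hN hR u hz hi).trans ?_
    refine mul_le_mul_of_nonneg_left ?_ (by positivity)
    have hzs : z ∈ coordinateSector D i σ := ⟨hzD, hz, hi⟩
    simp only [Fintype.sum_prod_type]
    refine le_trans ?_ (Finset.single_le_sum (fun i _ => by positivity) (Finset.mem_univ i))
    refine le_trans ?_ (Finset.single_le_sum (fun i _ => by positivity) (Finset.mem_univ σ))
    refine Finset.sum_le_sum fun τ _ => ?_
    rw [indicator_of_mem hzs]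
  refine (eLpNorm_le_sum_of_norm_le hp1 (fun j => ((hm j).indicator
    (measurableSet_coordinateSector hD j.1 j.2.1)).aestronglyMeasurable) hpt).trans ?_
  rw [ENNReal.coe_mul, mul_assoc, ENNReal.ofNNReal_toNNReal, ENNReal.ofNNReal_finsetSum,
    Finset.sum_mul]
  refine mul_le_mul_right (Finset.sum_le_sum fun j _ => ?_) _
  rw [eLpNorm_indicator_eq_eLpNorm_restrict (measurableSet_coordinateSector hD j.1 j.2.1)]
  refine (eLpNorm_mono_measure _ (Measure.restrict_mono le_rfl Measure.restrict_le_self)).trans ?_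
  refine hc j _ _ (hD.prod (measurableSet_upCone N)) (fun z hz => ?_) _
    (measurable_incrementQuotient r hu).stronglyMeasurable
  rw [apexMap_apply]
  refine ⟨?_, rankOneAdd_sign_mem_upCone hN hR hz.2.1 hz.2.2 _⟩
  rcases j with ⟨i, σ, τ⟩
  cases τ
  · exact hz.1.2
  · exact hz.1.1

/-- The fractional Korn inequality on sets that absorb a cone. -/
theorem exists_sobolevSeminorm_le_projectedSeminorm (d : ℕ) {s p : ℝ} (hs : 0 < s) (hs1 : s < 1)
    (hp : 1 ≤ p) {M : ℝ} (hM : 0 ≤ M) :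
    ∃ c : ℝ≥0, ∀ D : Set (Pt d), MeasurableSet D → (∀ x ∈ D, ∀ h ∈ upCone d M, x + h ∈ D) →
      ∀ u : Pt d → Pt d, Measurable u → sobolevSeminorm s p D u < ∞ →
        sobolevSeminorm s p D u ≤ c * projectedSeminorm s p D u := by
  have hr : 0 ≤ quotientOrder d s p := (quotientOrder_pos hs hp).le
  have hp1 : 1 ≤ ENNReal.ofReal p := by simpa using hp
  have hpt : ENNReal.ofReal p ≠ ∞ := by simp
  have hN : 0 ≤ 4 * (M + 1) := by positivity
  obtain ⟨c₁, h₁⟩ := exists_eLpNorm_incrementQuotient_le_gagliardoQuotient d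
    (r := quotientOrder d s p) hpt M (4 * (M + 1)) (by linarith)
  obtain ⟨c₂, h₂⟩ := exists_eLpNorm_secondQuotient_le d hr hp1 hpt hM
  obtain ⟨c₃, h₃⟩ := exists_eLpNorm_gagliardoQuotient_le d hr hp1 hpt hN
  refine ⟨c₃ * ((1 / 2 / (1 - 2 ^ (s - 1)) : ℝ).toNNReal * c₂), fun D hD hDM u hu hfin => ?_⟩
  rw [sobolevSeminorm_eq_eLpNorm hp hu] at hfin ⊢
  rw [projectedSeminorm_eq_eLpNorm hp hu]
  have hfin' := ne_top_of_le_ne_top (ENNReal.mul_ne_top ENNReal.coe_ne_top hfin.ne)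
    (h₁ D hD hDM u hu)
  refine (h₃ D hD u hu).trans ?_
  rw [ENNReal.coe_mul, mul_assoc, ENNReal.coe_mul, mul_assoc]
  refine mul_le_mul_right ?_ _
  refine (eLpNorm_incrementQuotient_le hs hs1 hp hD hu hfin').trans ?_
  exact mul_le_mul_right (h₂ D hD hDM u hu) _

/-! ### Reflections across a Lipschitz graph -/

/-- The map `(x', x_n) ↦ (x', f(x') + g(x_n - f(x')))`. -/
noncomputable def fiberMap (f : EuclideanSpace ℝ (Fin d) → ℝ) (g : ℝ → ℝ) (x : Pt d) : Pt d :=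
  WithLp.toLp 2 (Fin.snoc (α := fun _ => ℝ) (fun i : Fin d => x i.castSucc)
    (f (horizontalPart x) + g (x (Fin.last d) - f (horizontalPart x))))

theorem horizontalPart_fiberMap (f : EuclideanSpace ℝ (Fin d) → ℝ) (g : ℝ → ℝ) (x : Pt d) :
    horizontalPart (fiberMap f g x) = horizontalPart x := by
  ext i; simp [horizontalPart, fiberMap]

theorem fiberMap_last (f : EuclideanSpace ℝ (Fin d) → ℝ) (g : ℝ → ℝ) (x : Pt d) :
    fiberMap f g x (Fin.last d) =
      f (horizontalPart x) + g (x (Fin.last d) - f (horizontalPart x)) := by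
  simp [fiberMap]

theorem Pt.ext_parts {x y : Pt d} (h : horizontalPart x = horizontalPart y)
    (hl : x (Fin.last d) = y (Fin.last d)) : x = y := by
  ext i
  refine Fin.lastCases hl (fun j => ?_) i
  exact congrArg (fun w : EuclideanSpace ℝ (Fin d) => w j) h

/-- In the coordinates `(x', x_n - f(x'))` fiber maps act on the second coordinate alone, so they
compose like functions of one real variable. -/
theorem fiberMap_fiberMap (f : EuclideanSpace ℝ (Fin d) → ℝ) (g₁ g₂ : ℝ → ℝ) (x : Pt d) :
    fiberMap f g₁ (fiberMap f g₂ x) = fiberMap f (fun t => g₁ (g₂ t)) x := by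
  refine Pt.ext_parts ?_ ?_
  · simp only [horizontalPart_fiberMap]
  · simp only [fiberMap_last, horizontalPart_fiberMap, add_sub_cancel_left]

theorem fiberMap_id (f : EuclideanSpace ℝ (Fin d) → ℝ) {g : ℝ → ℝ} {x : Pt d}
    (hg : g (x (Fin.last d) - f (horizontalPart x)) = x (Fin.last d) - f (horizontalPart x)) :
    fiberMap f g x = x := by
  refine Pt.ext_parts (horizontalPart_fiberMap _ _ _) ?_
  rw [fiberMap_last, hg]; ring

theorem epigraphReflection_eq_fiberMap (f : EuclideanSpace ℝ (Fin d) → ℝ) (η : ℝ) :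
    epigraphReflection f η = fiberMap f (fun t => -(η * t)) := by
  funext x
  refine Pt.ext_parts ?_ ?_
  · rw [horizontalPart_fiberMap]; ext i; simp [horizontalPart, epigraphReflection]
  · rw [fiberMap_last]; simp [epigraphReflection]; ring

theorem lipschitzWith_fiberMap {f : EuclideanSpace ℝ (Fin d) → ℝ} {M G : ℝ≥0}
    (hf : LipschitzWith M f) {g : ℝ → ℝ} (hg : LipschitzWith G g) :
    LipschitzWith (1 + (M + G * (1 + M))) (fiberMap f g) := by
  refine LipschitzWith.of_dist_le_mul fun x y => ?_
  have h1 : ‖horizontalPart x - horizontalPart y‖ ≤ ‖x - y‖ := by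
    rw [← horizontalPart_sub]; exact norm_horizontalPart_le _
  have h2 : |f (horizontalPart x) - f (horizontalPart y)| ≤ M * ‖x - y‖ := by
    have := hf.dist_le_mul (horizontalPart x) (horizontalPart y)
    rw [dist_eq_norm, dist_eq_norm, Real.norm_eq_abs] at this
    exact this.trans (by gcongr)
  have h3 : |x (Fin.last d) - y (Fin.last d)| ≤ ‖x - y‖ := abs_apply_le_norm (x - y) _
  have h4 := hg.dist_le_mul (x (Fin.last d) - f (horizontalPart x))
    (y (Fin.last d) - f (horizontalPart y))
  rw [dist_eq_norm, dist_eq_norm, Real.norm_eq_abs, Real.norm_eq_abs] at h4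
  have h5 : |x (Fin.last d) - f (horizontalPart x) - (y (Fin.last d) - f (horizontalPart y))| ≤
      (1 + M) * ‖x - y‖ := by
    rw [sub_sub_sub_comm]
    refine (abs_sub _ _).trans ?_
    linarith
  rw [dist_eq_norm, dist_eq_norm]
  refine (norm_le_horizontalPart_add _).trans ?_
  rw [horizontalPart_sub, horizontalPart_fiberMap, horizontalPart_fiberMap, PiLp.sub_apply,
    fiberMap_last, fiberMap_last, add_sub_add_comm]
  have h6 := abs_add_le (f (horizontalPart x) - f (horizontalPart y))
    (g (x (Fin.last d) - f (horizontalPart x)) - g (y (Fin.last d) - f (horizontalPart y)))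
  have h7 : (G : ℝ) * |x (Fin.last d) - f (horizontalPart x) -
      (y (Fin.last d) - f (horizontalPart y))| ≤ G * ((1 + M) * ‖x - y‖) := by gcongr
  push_cast
  linarith

/-! ### Volume distortion, the null graph and the folding map -/

theorem volume_eq_smul_hausdorffMeasure :
    ∃ c : ℝ≥0, (volume : Measure (Pt d)) = c • Measure.hausdorffMeasure ((d + 1 : ℕ) : ℝ) := by
  have h : (Measure.hausdorffMeasure ((d + 1 : ℕ) : ℝ) : Measure (Pt d)).IsAddHaarMeasure := by
    simpa using isAddHaarMeasure_hausdorffMeasure (E := Pt d)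
  exact ⟨_, Measure.isAddLeftInvariant_eq_smul _ _⟩

/-- Lebesgue measure is a multiple of Hausdorff measure, whose behaviour under Lipschitz maps needs
neither differentiability of `g` nor measurability of `S`. -/
theorem LipschitzWith.volume_image_le {L : ℝ≥0} {g : Pt d → Pt d} (hg : LipschitzWith L g)
    (S : Set (Pt d)) : volume (g '' S) ≤ (L : ℝ≥0∞) ^ ((d + 1 : ℕ) : ℝ) * volume S := by
  obtain ⟨c, hc⟩ := volume_eq_smul_hausdorffMeasure (d := d)
  rw [hc, Measure.smul_apply, Measure.smul_apply, mul_smul_comm]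
  gcongr
  exact hg.hausdorffMeasure_image_le (Nat.cast_nonneg _) S

/-- The graph of `f`. -/
def fiberGraph (f : EuclideanSpace ℝ (Fin d) → ℝ) : Set (Pt d) :=
  {x | x (Fin.last d) = f (horizontalPart x)}

/-- The graph is a Lipschitz image of `ℝ^d`, hence of Hausdorff dimension at most `d < d + 1`. -/
theorem volume_fiberGraph {f : EuclideanSpace ℝ (Fin d) → ℝ} {M : ℝ≥0}
    (hf : LipschitzWith M f) : volume (fiberGraph f) = 0 := by
  let γ : EuclideanSpace ℝ (Fin d) → Pt d := fun w =>
    WithLp.toLp 2 (Fin.snoc (α := fun _ => ℝ) (fun i : Fin d => w i) (f w))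
  have hγ1 : ∀ w, horizontalPart (γ w) = w := fun w => by ext i; simp [horizontalPart, γ]
  have hγ2 : ∀ w, γ w (Fin.last d) = f w := fun w => by simp [γ]
  have hγ : LipschitzWith (1 + M) γ := by
    refine LipschitzWith.of_dist_le_mul fun x y => ?_
    have h2 := hf.dist_le_mul x y
    rw [dist_eq_norm, dist_eq_norm, Real.norm_eq_abs] at h2
    rw [dist_eq_norm, dist_eq_norm]
    refine (norm_le_horizontalPart_add _).trans ?_
    rw [horizontalPart_sub, hγ1, hγ1, PiLp.sub_apply, hγ2, hγ2]
    push_cast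
    linarith
  have hsub : fiberGraph f ⊆ range γ := fun x hx =>
    ⟨horizontalPart x, Pt.ext_parts (hγ1 _) ((hγ2 _).trans (Eq.symm hx))⟩
  have hdim : dimH (range γ) < ((d + 1 : ℕ) : ℝ≥0) := by
    refine hγ.dimH_range_le.trans_lt ?_
    rw [Real.dimH_univ_eq_finrank]
    simp only [finrank_euclideanSpace, Fintype.card_fin]
    exact_mod_cast Nat.lt_succ_self d
  have h0 := hausdorffMeasure_of_dimH_lt hdim
  obtain ⟨c, hc⟩ := volume_eq_smul_hausdorffMeasure (d := d)
  refine measure_mono_null hsub ?_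
  rw [hc, Measure.smul_apply]
  rw [NNReal.coe_natCast] at h0
  rw [h0, smul_zero]

theorem measurableSet_epigraph {f : EuclideanSpace ℝ (Fin d) → ℝ} (hf : Continuous f) :
    MeasurableSet (epigraph f) :=
  (isOpen_lt (by have := continuous_horizontalPart (d := d); fun_prop)
    (by fun_prop)).measurableSet

theorem add_mem_epigraph {f : EuclideanSpace ℝ (Fin d) → ℝ} {M : ℝ≥0} (hf : LipschitzWith M f)
    {x h : Pt d} (hx : x ∈ epigraph f) (hh : h ∈ upCone d M) : x + h ∈ epigraph f := by
  have h1 := hf.dist_le_mul (horizontalPart (x + h)) (horizontalPart x)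
  rw [horizontalPart_add, dist_eq_norm, dist_eq_norm, add_sub_cancel_left,
    Real.norm_eq_abs] at h1
  have h2 := le_abs_self (f (horizontalPart x + horizontalPart h) - f (horizontalPart x))
  have h3 : f (horizontalPart x) < x (Fin.last d) := hx
  have h4 : (M : ℝ) * ‖horizontalPart h‖ < h (Fin.last d) := hh
  change f (horizontalPart (x + h)) < (x + h) (Fin.last d)
  rw [horizontalPart_add, PiLp.add_apply]
  linarith

/-- The folding map: the identity above the graph and the reflection `Φ_η` below it. -/
noncomputable def foldMap (f : EuclideanSpace ℝ (Fin d) → ℝ) (η : ℝ) : Pt d → Pt d :=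
  fiberMap f (fun t => max t (-(η * t)))

theorem lipschitzWith_neg_mul (η : ℝ≥0) : LipschitzWith η (fun t : ℝ => -((η : ℝ) * t)) := by
  refine LipschitzWith.of_dist_le_mul fun x y => ?_
  rw [dist_neg_neg, Real.dist_eq, Real.dist_eq, ← mul_sub, abs_mul, NNReal.abs_eq]

theorem lipschitzWith_foldMap {f : EuclideanSpace ℝ (Fin d) → ℝ} {M : ℝ≥0}
    (hf : LipschitzWith M f) (η : ℝ≥0) :
    LipschitzWith (1 + (M + max 1 η * (1 + M))) (foldMap f η) :=
  lipschitzWith_fiberMap hf (LipschitzWith.id.max (lipschitzWith_neg_mul η))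

theorem foldMap_of_mem_epigraph {f : EuclideanSpace ℝ (Fin d) → ℝ} {η : ℝ} (hη : 0 ≤ η)
    {x : Pt d} (hx : x ∈ epigraph f) : foldMap f η x = x := by
  have h : 0 < x (Fin.last d) - f (horizontalPart x) := sub_pos.2 hx
  exact fiberMap_id f (max_eq_left (by nlinarith [mul_nonneg hη h.le]))

theorem foldMap_of_mem_strictHypograph {f : EuclideanSpace ℝ (Fin d) → ℝ} {η : ℝ} (hη : 0 ≤ η)
    {x : Pt d} (hx : x ∈ strictHypograph f) : foldMap f η x = epigraphReflection f η x := by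
  have h : x (Fin.last d) - f (horizontalPart x) < 0 := sub_neg.2 hx
  rw [epigraphReflection_eq_fiberMap, foldMap, fiberMap, fiberMap, max_eq_right]
  nlinarith

/-- The preimage of `S` consists of `S` within the epigraph, a part below the graph and part of the
null graph. The inverse of the reflection with ratio `η` is the reflection with ratio `η⁻¹`, so the
part below is a Lipschitz image of `S ∩ epigraph f`. -/
theorem map_foldMap_le {f : EuclideanSpace ℝ (Fin d) → ℝ} {M : ℝ≥0} (hf : LipschitzWith M f)
    {η : ℝ≥0} (hη : 0 < η) :
    (volume : Measure (Pt d)).map (foldMap f η) ≤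
      (1 + ((1 + (M + η⁻¹ * (1 + M)) : ℝ≥0) : ℝ≥0∞) ^ ((d + 1 : ℕ) : ℝ)) •
        volume.restrict (epigraph f) := by
  refine Measure.le_iff.2 fun S hS => ?_
  rw [Measure.map_apply (lipschitzWith_foldMap hf η).continuous.measurable hS,
    Measure.smul_apply, Measure.restrict_apply hS, smul_eq_mul, add_mul, one_mul]
  have hη' : (0 : ℝ) < η := hη
  have hL := lipschitzWith_fiberMap hf (lipschitzWith_neg_mul η⁻¹)
  have hsub : foldMap f η ⁻¹' S ⊆ (S ∩ epigraph f) ∪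
      (fiberMap f (fun t => -(((η⁻¹ : ℝ≥0) : ℝ) * t)) '' (S ∩ epigraph f)) ∪ fiberGraph f := by
    intro x hx
    rcases lt_trichotomy (x (Fin.last d)) (f (horizontalPart x)) with h | h | h
    · refine Or.inl (Or.inr ⟨foldMap f η x, ⟨hx, ?_⟩, ?_⟩)
      · rw [foldMap_of_mem_strictHypograph hη'.le h, epigraphReflection_eq_fiberMap]
        change f (horizontalPart _) < _
        rw [horizontalPart_fiberMap, fiberMap_last]
        nlinarith
      · rw [foldMap_of_mem_strictHypograph hη'.le h, epigraphReflection_eq_fiberMap,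
          fiberMap_fiberMap]
        refine fiberMap_id f ?_
        push_cast
        field_simp
    · exact Or.inr h
    · have hx' : foldMap f η x ∈ S := hx
      rw [foldMap_of_mem_epigraph hη'.le h] at hx'
      exact Or.inl (Or.inl ⟨hx', h⟩)
  refine (measure_mono hsub).trans ((measure_union_le _ _).trans ?_)
  rw [volume_fiberGraph hf, add_zero]
  refine (measure_union_le _ _).trans (add_le_add_right ?_ _)
  exact hL.volume_image_le _

/-! ### Boundedness of the extension -/

/-- Compositions with the folding map are bounded in `L^p` and in the Gagliardo seminorm. -/
theorem exists_foldMap_bound (d : ℕ) {s p : ℝ} (hs : 0 < s) (hp : 1 ≤ p) (M : ℝ≥0) {η : ℝ≥0}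
    (hη : 0 < η) :
    ∃ c : ℝ≥0, ∀ f : EuclideanSpace ℝ (Fin d) → ℝ, LipschitzWith M f →
      ∀ u : Pt d → Pt d, Measurable u →
        eLpNorm (fun x => u (foldMap f η x)) (ENNReal.ofReal p) volume ≤
            c * eLpNorm u (ENNReal.ofReal p) (volume.restrict (epigraph f)) ∧
        sobolevSeminorm s p univ (fun x => u (foldMap f η x)) ≤
            c * sobolevSeminorm s p (epigraph f) u := by
  set r := quotientOrder d s p with hr
  have hr0 : 0 < r := quotientOrder_pos hs hp
  set q := ENNReal.ofReal p with hq
  have hqt : q ≠ ∞ := by simp [hq]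
  set L : ℝ≥0 := 1 + (M + max 1 η * (1 + M)) with hL
  have hL0 : (0 : ℝ) < L := by rw [hL]; positivity
  set κ : ℝ≥0∞ := 1 + ((1 + (M + η⁻¹ * (1 + M)) : ℝ≥0) : ℝ≥0∞) ^ ((d + 1 : ℕ) : ℝ) with hκ
  have hκt : κ ≠ ∞ := by
    refine ENNReal.add_ne_top.2 ⟨ENNReal.one_ne_top, ?_⟩
    exact ENNReal.rpow_ne_top_of_nonneg (Nat.cast_nonneg _) ENNReal.coe_ne_top
  have h1t : κ ^ (1 / q).toReal ≠ ∞ := ENNReal.rpow_ne_top_of_nonneg (by positivity) hκt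
  have h2t : (κ * κ) ^ (1 / q).toReal ≠ ∞ :=
    ENNReal.rpow_ne_top_of_nonneg (by positivity) (ENNReal.mul_ne_top hκt hκt)
  have h3t : ENNReal.ofReal ((L : ℝ) ^ r) * (κ * κ) ^ (1 / q).toReal ≠ ∞ :=
    ENNReal.mul_ne_top ENNReal.ofReal_ne_top h2t
  refine ⟨(κ ^ (1 / q).toReal).toNNReal +
    (ENNReal.ofReal ((L : ℝ) ^ r) * (κ * κ) ^ (1 / q).toReal).toNNReal, fun f hf u hu => ?_⟩
  rw [ENNReal.coe_add, ENNReal.coe_toNNReal h1t, ENNReal.coe_toNNReal h3t]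
  have hmap := map_foldMap_le hf hη
  rw [← hκ] at hmap
  have hlip := lipschitzWith_foldMap hf η
  rw [← hL] at hlip
  have hψ : Measurable (foldMap f η) := hlip.continuous.measurable
  constructor
  · refine (eLpNorm_comp_le_of_map_le hψ hmap hqt hu.stronglyMeasurable).trans ?_
    gcongr
    exact le_self_add
  · have hv : Measurable fun x => u (foldMap f η x) := hu.comp hψ
    rw [sobolevSeminorm_eq_eLpNorm hp hv, sobolevSeminorm_eq_eLpNorm hp hu, univ_prod_univ,
      Measure.restrict_univ, ← hr]
    have hpt : ∀ z, ‖gagliardoQuotient r (fun x => u (foldMap f η x)) z‖ ≤ (L : ℝ) ^ r *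
        ‖gagliardoQuotient r u (Prod.map (foldMap f η) (foldMap f η) z)‖ := by
      intro z
      simp only [gagliardoQuotient, norm_smul, Prod.map_fst, Prod.map_snd,
        Real.norm_of_nonneg (Real.rpow_nonneg (norm_nonneg _) _)]
      rcases eq_or_ne (foldMap f η z.1) (foldMap f η z.2) with h | h
      · simp [h]
      · rw [← mul_assoc]
        gcongr
        refine rpow_neg_le_of_le_mul (norm_pos_iff.2 (sub_ne_zero.2 h)) hL0 hr0.le ?_
        have := hlip.dist_le_mul z.1 z.2
        rwa [dist_eq_norm, dist_eq_norm] at this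
    have hmap2 : (volume.prod volume : Measure (Pt d × Pt d)).map
        (Prod.map (foldMap f η) (foldMap f η)) ≤
        (κ * κ) • (volume.prod volume).restrict (epigraph f ×ˢ epigraph f) := by
      rw [← Measure.map_prod_map _ _ hψ hψ, ← Measure.prod_restrict]
      refine (Measure.prod_mono hmap hmap).trans (le_of_eq ?_)
      rw [Measure.prod_smul_left, Measure.prod_smul_right, smul_smul]
    refine (eLpNorm_le_mul_eLpNorm_of_ae_le_mul (ae_of_all _ hpt) q).trans ?_
    refine (mul_le_mul_right (eLpNorm_comp_le_of_map_le (hψ.prodMap hψ) hmap2 hqt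
      (measurable_gagliardoQuotient r hu).stronglyMeasurable) _).trans ?_
    rw [← mul_assoc]
    gcongr
    exact le_add_self

/-- The diagonal operator with entries `a, …, a, b`. -/
noncomputable def diagonalScale (d : ℕ) (a b : ℝ) : Pt d →L[ℝ] Pt d :=
  LinearMap.toContinuousLinearMap
    { toFun := fun v => WithLp.toLp 2 fun i => (if i = Fin.last d then b else a) * v i
      map_add' := fun v w => by ext i; simp [mul_add]
      map_smul' := fun t v => by ext i; simp [mul_left_comm] }

theorem diagonalScale_apply (a b : ℝ) (v : Pt d) (i : Fin (d + 1)) :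
    diagonalScale d a b v i = (if i = Fin.last d then b else a) * v i := rfl

/-- Above the graph both folds are the identity, and the formula still returns `u` because the
coefficients satisfy `k + ℓ = 1` and `m + q = 1`. -/
theorem nitscheExtension_eq_foldMap {f : EuclideanSpace ℝ (Fin d) → ℝ} {lam mu : ℝ}
    (hlam : 0 ≤ lam) (hmu : 0 ≤ mu) (hne : mu - lam ≠ 0) (u : Pt d → Pt d) {x : Pt d}
    (hx : x ∉ fiberGraph f) :
    nitscheExtension f lam mu u x =
      diagonalScale d ((1 + mu) / (mu - lam)) (-(lam * (1 + mu) / (mu - lam)))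
          (u (foldMap f lam x)) +
        diagonalScale d (-((1 + lam) / (mu - lam))) (mu * (1 + lam) / (mu - lam))
          (u (foldMap f mu x)) := by
  rcases lt_trichotomy (x (Fin.last d)) (f (horizontalPart x)) with h | h | h
  · have h1 : x ∈ strictHypograph f := h
    have h2 : x ∉ epigraph f := fun h3 => lt_asymm h h3
    rw [foldMap_of_mem_strictHypograph hlam h1, foldMap_of_mem_strictHypograph hmu h1]
    ext i
    simp only [nitscheExtension, LinearMap.coe_mk, AddHom.coe_mk, if_neg h2, if_pos h1,
      nitscheComponent, PiLp.add_apply, diagonalScale_apply]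
    split_ifs <;> rfl
  · exact absurd h hx
  · have h1 : x ∈ epigraph f := h
    rw [foldMap_of_mem_epigraph hlam h1, foldMap_of_mem_epigraph hmu h1]
    ext i
    simp only [nitscheExtension, LinearMap.coe_mk, AddHom.coe_mk, if_pos h1,
      PiLp.add_apply, diagonalScale_apply]
    split_ifs
    · field_simp; ring
    · field_simp; ring

/-- The bound on the pushforward says in particular that the fold pulls null subsets of the epigraph
back to null sets. -/
theorem ae_comp_foldMap_eq {f : EuclideanSpace ℝ (Fin d) → ℝ} {M : ℝ≥0}
    (hf : LipschitzWith M f) {η : ℝ≥0} (hη : 0 < η) {u v : Pt d → Pt d}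
    (h : u =ᵐ[volume.restrict (epigraph f)] v) :
    ∀ᵐ x, u (foldMap f η x) = v (foldMap f η x) :=
  ae_of_ae_map (lipschitzWith_foldMap hf η).continuous.measurable.aemeasurable
    (ae_mono (map_foldMap_le hf hη) (Measure.ae_smul_measure h _))

theorem ae_notMem_fiberGraph {f : EuclideanSpace ℝ (Fin d) → ℝ} {M : ℝ≥0}
    (hf : LipschitzWith M f) : ∀ᵐ x, x ∉ fiberGraph f :=
  measure_eq_zero_iff_ae_notMem.1 (volume_fiberGraph hf)

theorem nitscheExtension_congr_ae {f : EuclideanSpace ℝ (Fin d) → ℝ} {M : ℝ≥0}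
    (hf : LipschitzWith M f) {lam mu : ℝ≥0} (hlam : 0 < lam) (hmu : 0 < mu)
    (hne : (mu : ℝ) - lam ≠ 0) {u v : Pt d → Pt d} (h : u =ᵐ[volume.restrict (epigraph f)] v) :
    nitscheExtension f lam mu u =ᵐ[volume] nitscheExtension f lam mu v := by
  filter_upwards [ae_notMem_fiberGraph hf, ae_comp_foldMap_eq hf hlam h,
    ae_comp_foldMap_eq hf hmu h] with x hx h1 h2
  rw [nitscheExtension_eq_foldMap lam.coe_nonneg mu.coe_nonneg hne u hx,
    nitscheExtension_eq_foldMap lam.coe_nonneg mu.coe_nonneg hne v hx, h1, h2]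

theorem sobolevSeminorm_add_clm_le {s p : ℝ} (hp : 1 ≤ p) {D : Set (Pt d)} (A B : Pt d →L[ℝ] Pt d)
    {v w : Pt d → Pt d} (hv : Measurable v) (hw : Measurable w) :
    sobolevSeminorm s p D (fun x => A (v x) + B (w x)) ≤
      ‖A‖ₑ * sobolevSeminorm s p D v + ‖B‖ₑ * sobolevSeminorm s p D w := by
  have hp1 : 1 ≤ ENNReal.ofReal p := by simpa using hp
  have hAB : Measurable fun x => A (v x) + B (w x) := by fun_prop
  rw [sobolevSeminorm_eq_eLpNorm hp hv, sobolevSeminorm_eq_eLpNorm hp hw,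
    sobolevSeminorm_eq_eLpNorm hp hAB]
  set r := quotientOrder d s p
  have h1 : gagliardoQuotient r (fun x => A (v x) + B (w x)) =
      (fun z => A (gagliardoQuotient r v z)) + (fun z => B (gagliardoQuotient r w z)) := by
    funext z
    simp only [gagliardoQuotient, Pi.add_apply, map_smul, map_sub]
    module
  have hgv := measurable_gagliardoQuotient r hv
  have hgw := measurable_gagliardoQuotient r hw
  have hle : ∀ (T : Pt d →L[ℝ] Pt d) (g : Pt d × Pt d → Pt d) (μ : Measure (Pt d × Pt d)),
      eLpNorm (fun z => T (g z)) (ENNReal.ofReal p) μ ≤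
        ‖T‖ₑ * eLpNorm g (ENNReal.ofReal p) μ := fun T g μ => by
    rw [← ofReal_norm T]
    exact eLpNorm_le_mul_eLpNorm_of_ae_le_mul (ae_of_all _ fun z => T.le_opNorm _) _
  rw [h1]
  refine (eLpNorm_add_le ?_ ?_ hp1).trans (add_le_add (hle _ _ _) (hle _ _ _))
  · exact (A.continuous.measurable.comp hgv).aestronglyMeasurable
  · exact (B.continuous.measurable.comp hgw).aestronglyMeasurable

theorem eLpNorm_add_clm_le {p : ℝ≥0∞} (hp : 1 ≤ p) {μ : Measure (Pt d)} (A B : Pt d →L[ℝ] Pt d)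
    {v w : Pt d → Pt d} (hv : Measurable v) (hw : Measurable w) :
    eLpNorm (fun x => A (v x) + B (w x)) p μ ≤
      ‖A‖ₑ * eLpNorm v p μ + ‖B‖ₑ * eLpNorm w p μ := by
  have hle : ∀ (T : Pt d →L[ℝ] Pt d) (g : Pt d → Pt d),
      eLpNorm (fun z => T (g z)) p μ ≤ ‖T‖ₑ * eLpNorm g p μ := fun T g => by
    rw [← ofReal_norm T]
    exact eLpNorm_le_mul_eLpNorm_of_ae_le_mul (ae_of_all _ fun z => T.le_opNorm _) _
  refine (eLpNorm_add_le ?_ ?_ hp).trans (add_le_add (hle _ _) (hle _ _))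
  · exact (A.continuous.measurable.comp hv).aestronglyMeasurable
  · exact (B.continuous.measurable.comp hw).aestronglyMeasurable

/-- The extension is bounded in `L^p` and in the Gagliardo seminorm. -/
theorem exists_nitscheExtension_bound (d : ℕ) {s p : ℝ} (hs : 0 < s) (hp : 1 ≤ p) (M : ℝ≥0)
    {lam mu : ℝ≥0} (hlam : 0 < lam) (hmu : 0 < mu) (hne : (mu : ℝ) - lam ≠ 0) :
    ∃ c : ℝ≥0, ∀ f : EuclideanSpace ℝ (Fin d) → ℝ, LipschitzWith M f →
      ∀ u : Pt d → Pt d, Measurable u →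
        AEStronglyMeasurable (nitscheExtension f lam mu u) volume ∧
        eLpNorm (nitscheExtension f lam mu u) (ENNReal.ofReal p) volume ≤
            c * eLpNorm u (ENNReal.ofReal p) (volume.restrict (epigraph f)) ∧
        sobolevSeminorm s p univ (nitscheExtension f lam mu u) ≤
            c * sobolevSeminorm s p (epigraph f) u := by
  obtain ⟨c₁, h₁⟩ := exists_foldMap_bound d hs hp M hlam
  obtain ⟨c₂, h₂⟩ := exists_foldMap_bound d hs hp M hmu
  set A := diagonalScale d ((1 + mu) / (mu - lam)) (-(lam * (1 + mu) / (mu - lam)))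
  set B := diagonalScale d (-((1 + lam) / (mu - lam))) (mu * (1 + lam) / (mu - lam))
  refine ⟨‖A‖₊ * c₁ + ‖B‖₊ * c₂, fun f hf u hu => ?_⟩
  have hv : Measurable fun x => u (foldMap f lam x) :=
    hu.comp (lipschitzWith_foldMap hf lam).continuous.measurable
  have hw : Measurable fun x => u (foldMap f mu x) :=
    hu.comp (lipschitzWith_foldMap hf mu).continuous.measurable
  have hE : nitscheExtension f lam mu u =ᵐ[volume]
      fun x => A (u (foldMap f lam x)) + B (u (foldMap f mu x)) := by
    filter_upwards [ae_notMem_fiberGraph hf] with x hx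
    exact nitscheExtension_eq_foldMap lam.coe_nonneg mu.coe_nonneg hne u hx
  have hE' : nitscheExtension f lam mu u =ᵐ[volume.restrict univ]
      fun x => A (u (foldMap f lam x)) + B (u (foldMap f mu x)) := by
    rwa [Measure.restrict_univ]
  have hm : Measurable fun x => A (u (foldMap f lam x)) + B (u (foldMap f mu x)) :=
    (A.continuous.measurable.comp hv).add (B.continuous.measurable.comp hw)
  push_cast
  simp only [add_mul, mul_assoc]
  refine ⟨hm.aestronglyMeasurable.congr hE.symm, ?_, ?_⟩
  · rw [eLpNorm_congr_ae hE]
    refine (eLpNorm_add_clm_le (by simpa using hp) A B hv hw).trans ?_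
    exact add_le_add (mul_le_mul_right (h₁ f hf u hu).1 _) (mul_le_mul_right (h₂ f hf u hu).1 _)
  · rw [sobolevSeminorm_congr_ae hE']
    refine (sobolevSeminorm_add_clm_le hp A B hv hw).trans ?_
    exact add_le_add (mul_le_mul_right (h₁ f hf u hu).2 _) (mul_le_mul_right (h₂ f hf u hu).2 _)

/-! ### Choice of constants and conclusion -/

theorem reflectionParameter_mem {M : ℝ} (hM : 0 ≤ M) (d : ℕ) :
    0 < reflectionParameter (d + 1) 1 M ∧ reflectionParameter (d + 1) 1 M ≤ 1 / 2 := by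
  have h1 : (1 : ℝ) ≤ √((d + 1 : ℕ) : ℝ) := Real.one_le_sqrt.2 (by simp)
  have h2 : 2 ≤ 2 * 1 * √((d + 1 : ℕ) : ℝ) * (1 + M) := by nlinarith
  unfold reflectionParameter
  refine ⟨by positivity, ?_⟩
  exact one_div_le_one_div_of_le two_pos h2

theorem mainTheorem3 (d : ℕ) :
    ∃ c₂ : ℝ, 1 ≤ c₂ ∧
    ∀ s p : ℝ, 0 < s → s < 1 → 1 ≤ p →
    ∃ c : ℝ, 0 < c ∧
    ∀ M : ℝ≥0, ∃ C K : ℝ, 0 < C ∧ 0 < K ∧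
    ∀ f : EuclideanSpace ℝ (Fin d) → ℝ, LipschitzWith M f →
    ∀ δ : ℝ, δ = reflectionParameter (d + 1) c₂ M →
      (∀ u v : EuclideanSpace ℝ (Fin (d + 1)) → EuclideanSpace ℝ (Fin (d + 1)),
        u =ᵐ[volume.restrict (epigraph f)] v →
          nitscheExtension f (1 - δ) (1 + δ) u =ᵐ[volume]
            nitscheExtension f (1 - δ) (1 + δ) v) ∧
      ∀ u : EuclideanSpace ℝ (Fin (d + 1)) → EuclideanSpace ℝ (Fin (d + 1)),
        MemSobolev s p (epigraph f) u →
          EqOn (nitscheExtension f (1 - δ) (1 + δ) u) u (epigraph f) ∧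
          MemSobolev s p univ (nitscheExtension f (1 - δ) (1 + δ) u) ∧
          sobolevNorm s p univ (nitscheExtension f (1 - δ) (1 + δ) u) ≤
            ENNReal.ofReal K * sobolevNorm s p (epigraph f) u ∧
          projectedSeminorm s p univ (nitscheExtension f (1 - δ) (1 + δ) u) ≤
            ENNReal.ofReal C * projectedSeminorm s p (epigraph f) u +
              ENNReal.ofReal (c * (1 + (M : ℝ)) ^ (2 + ((d + 1 : ℕ) : ℝ) / (2 * p)) * M) *
                sobolevSeminorm s p (epigraph f) u := by
  -- With `c₂ = 1` one has `0 < δ ≤ 1 / 2`, hence `0 < λ < μ`, which is all that is required of the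
  -- parameters. The value `c = 1` is arbitrary.
  refine ⟨1, le_rfl, fun s p hs hs1 hp => ⟨1, one_pos, fun M => ?_⟩⟩
  obtain ⟨hδ0, hδ1⟩ := reflectionParameter_mem M.coe_nonneg d
  set δ₀ := reflectionParameter (d + 1) 1 M
  obtain ⟨lam, hlam⟩ : ∃ lam : ℝ≥0, (lam : ℝ) = 1 - δ₀ := ⟨⟨1 - δ₀, by linarith⟩, rfl⟩
  obtain ⟨mu, hmu⟩ : ∃ mu : ℝ≥0, (mu : ℝ) = 1 + δ₀ := ⟨⟨1 + δ₀, by linarith⟩, rfl⟩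
  have hlam0 : 0 < lam := by rw [← NNReal.coe_pos, hlam]; linarith
  have hmu0 : 0 < mu := by rw [← NNReal.coe_pos, hmu]; linarith
  have hne : (mu : ℝ) - lam ≠ 0 := by rw [hlam, hmu]; linarith
  obtain ⟨k, hk⟩ := exists_nitscheExtension_bound d hs hp M hlam0 hmu0 hne
  obtain ⟨a, ha⟩ := exists_sobolevSeminorm_le_projectedSeminorm d hs hs1 hp M.coe_nonneg
  -- The summands 1 only make the constants positive. Both `k` and `a` are fixed before `f`, since
  -- `δ` depends on `M` and `n` alone.
  refine ⟨k * a + 1, k + 1, by positivity, by positivity, fun f hf δ hδ => ?_⟩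
  subst hδ
  rw [← hlam, ← hmu]
  refine ⟨fun u v huv => nitscheExtension_congr_ae hf hlam0 hmu0 hne huv, fun u hu => ?_⟩
  -- The estimates are stated for measurable fields; `u` is replaced by a measurable representative
  -- and the bounds are transferred back.
  obtain ⟨v, hv, huv⟩ : ∃ v : Pt d → Pt d, Measurable v ∧ u =ᵐ[volume.restrict (epigraph f)] v :=
    ⟨_, hu.1.aestronglyMeasurable.stronglyMeasurable_mk.measurable,
      hu.1.aestronglyMeasurable.ae_eq_mk⟩
  have hEuv := nitscheExtension_congr_ae hf hlam0 hmu0 hne huv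
  obtain ⟨hm, hLp, hSob⟩ := hk f hf v hv
  rw [← eLpNorm_congr_ae hEuv, ← eLpNorm_congr_ae huv] at hLp
  have hEuv' : nitscheExtension f lam mu u =ᵐ[volume.restrict univ]
      nitscheExtension f lam mu v := by rwa [Measure.restrict_univ]
  rw [← sobolevSeminorm_congr_ae hEuv', ← sobolevSeminorm_congr_ae huv] at hSob
  have hKorn := ha (epigraph f) (measurableSet_epigraph hf.continuous)
    (fun x hx h hh => add_mem_epigraph hf hx hh) v hv
    (by rw [← sobolevSeminorm_congr_ae huv]; exact hu.2)
  rw [← sobolevSeminorm_congr_ae huv, ← projectedSeminorm_congr_ae huv] at hKorn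
  have hK : ENNReal.ofReal (k + 1) = k + 1 := by
    rw [ENNReal.ofReal_add k.coe_nonneg zero_le_one, ENNReal.ofReal_coe_nnreal, ENNReal.ofReal_one]
  have hC : ENNReal.ofReal (k * a + 1) = k * a + 1 := by
    rw [ENNReal.ofReal_add (by positivity) zero_le_one, ENNReal.ofReal_mul k.coe_nonneg,
      ENNReal.ofReal_coe_nnreal, ENNReal.ofReal_coe_nnreal, ENNReal.ofReal_one]
  refine ⟨fun x hx => ?_, ⟨⟨?_, ?_⟩, ?_⟩, ?_, ?_⟩
  · simp [nitscheExtension, hx]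
  · rw [Measure.restrict_univ]
    exact hm.congr hEuv.symm
  · rw [Measure.restrict_univ]
    exact hLp.trans_lt (ENNReal.mul_lt_top ENNReal.coe_lt_top hu.1.2)
  · exact hSob.trans_lt (ENNReal.mul_lt_top ENNReal.coe_lt_top hu.2)
  · rw [sobolevNorm, sobolevNorm, Measure.restrict_univ, hK, mul_add]
    gcongr
    · exact hLp.trans (mul_le_mul_left le_self_add _)
    · exact hSob.trans (mul_le_mul_left le_self_add _)
  -- The Korn inequality already bounds the left side by the first term alone.
  · refine le_add_right ?_
    refine (projectedSeminorm_le_sobolevSeminorm hp _ _).trans (hSob.trans ?_)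
    refine (mul_le_mul_right hKorn _).trans ?_
    rw [hC, ← mul_assoc]
    exact mul_le_mul_left le_self_add _
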